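/- For $t\in(-1,1)$ let $$E(t)=-\frac{1+t}{2}\log(1+t)-\frac{1-t}{2}\log(1-t),$$ put $t_*=0.9$, and define $$\beta=\frac{\tfrac32t_*^2+5E(t_*)-t_*E'(t_*)}{t_*^6},\qquad h=\frac{-2t_*^2-6E(t_*)+t_*E'(t_*)}{t_*^5}.$$ To four decimals, $\beta\approx 0.1258$ and $h\approx 0.0386$ (that is, $|\beta-0.1258|<5\cdot10^{-5}$ and $|h-0.0386|<5\cdot10^{-5}$). For $a\in[0,1]$ let $$f(a)=\beta(2a-1)^6+h(2a-1)^5+\tfrac12(2a-1)^2,\quad I(a)=-a\log a-(1-a)\log(1-a),\quad A(a)=f(a)+I(a),$$ with $0\log 0=0$. For $n\ge1$ let $\omega=(\omega_1,\dots,\omega_n)\in\{1,-1\}^n$ be distributed according to the Gibbs measure $\mu_n(\omega)\propto\exp\big(nf(\bar\omega_+)\big)$, where $\bar\omega_+=\frac1n|\{i:\omega_i=1\}|$, and let $M_n=\omega_1+\dots+\omega_n=n(2\bar\omega_+-1)$. A maximizer $a_0\in(0,1)$ of $A$ over $[0,1]$ is called $2m$-regular if $A^{(k)}(a_0)=0$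 for $1\le k\le 2m-1$ and $A^{(2m)}(a_0)<0$. For laws $\mu,\nu$ on $\mathbb R$ with finite first moments let $d_{\mathrm W}(\mu,\nu)=\sup|\int g\,d\mu-\int g\,d\nu|$, the supremum being over all $1$-Lipschitz functions $g:\mathbb R\to\mathbb R$. Theorem. The function $A$ has exactly two maximizers over $[0,1]$, namely $1/2$, which is $4$-regular, and $0.95$, which is $2$-regular. Moreover $M_n/n\to0$ in law as $n\to\infty$. Finally, there is $\delta_0>0$ such that for every $\delta\in(0,\delta_0)$, as $n\to\infty$ (with implied constants that may depend on $\delta$), $$d_{\mathrm W}\Big(\mathcal L\big(n^{-3/4}M_n\,\big|\,\bar\omega_+\in(\tfrac12-\delta,\tfrac12+\delta)\big),\mathcal L(Y)\Big)=O(n^{-1/4}),$$ where $Y$ has density proportional to $\exp\Big(\dfrac{A^{(4)}(1/2)}{2^4\,4!}x^4\Big)$, and $$d_{\mathrm W}\Big(\mathcal L\Big(\frac{M_n-0.9n}{\sqrt n}\,\Big|\,\bar\omega_+\in(0.95-\delta,0.95+\delta)\Big),N\Big(0,\frac{4}{|A''(0.95)|}\Big)\Big)=O(n^{-1/2}).$$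 -/

import Mathlib

open MeasureTheory ProbabilityTheory Filter Set
open scoped ENNReal NNReal Topology

namespace SixSpin

noncomputable section

/-- The space `Ω_n = {1, -1}^n` of spin configurations. -/
abbrev Config (n : ℕ) : Type := Fin n → ℤˣ

instance : MeasurableSingletonClass ℤˣ where
  measurableSet_singleton u := by
    refine ⟨{(u : ℤ)}, measurableSet_singleton _, ?_⟩
    ext v
    simp [Units.ext_iff]

/-- The magnetization `M_n(ω) = ω_1 + ... + ω_n`. -/
def magnetization {n : ℕ} (ω : Config n) : ℝ := ∑ i, ((ω i : ℤ) : ℝ)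

/-- The fraction of plus spins, `|{i : ω_i = 1}| / n`. -/
def plusFraction {n : ℕ} (ω : Config n) : ℝ :=
  ((Finset.univ.filter fun i => ω i = 1).card : ℝ) / (n : ℝ)

/-- The Gibbs measure on `{1, -1}^n` with Hamiltonian `n f(plusFraction ω)`: the probability
measure with `μ_n(ω) ∝ exp (n f(plusFraction ω))`. -/
def gibbs (f : ℝ → ℝ) (n : ℕ) : Measure (Config n) :=
  (Measure.count : Measure (Config n)).tilted fun ω => (n : ℝ) * f (plusFraction ω)

instance (f : ℝ → ℝ) (n : ℕ) : IsProbabilityMeasure (gibbs f n) :=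
  isProbabilityMeasure_tilted Integrable.of_finite

/-- The entropy of a spin of mean `t`, normalised to vanish at `t = 0`. -/
def spinEntropy (t : ℝ) : ℝ :=
  -((1 + t) / 2) * Real.log (1 + t) - ((1 - t) / 2) * Real.log (1 - t)

/-- The non-zero critical point `t_* = 0.9`. -/
def tStar : ℝ := 9 / 10

/-- The coefficient of the six-spin interaction. -/
def beta : ℝ :=
  (3 * tStar ^ 2 / 2 + 5 * spinEntropy tStar - tStar * deriv spinEntropy tStar) / tStar ^ 6

/-- The coefficient of the five-spin interaction. -/
def field : ℝ :=
  (-2 * tStar ^ 2 - 6 * spinEntropy tStar + tStar * deriv spinEntropy tStar) / tStar ^ 5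

/-- The energy of the six-spin model, as a function of the fraction `a` of plus spins (so that
`2 * a - 1` is the mean spin). -/
def energy (a : ℝ) : ℝ :=
  beta * (2 * a - 1) ^ 6 + field * (2 * a - 1) ^ 5 + (2 * a - 1) ^ 2 / 2

/-- The function `A = f + I` on `[0, 1]`; `Real.binEntropy a` is
`I(a) = -a log a + (a - 1) log (1 - a)`. -/
def freeEnergy (a : ℝ) : ℝ := energy a + Real.binEntropy a

/-- `a` is a maximizer of `A` over `[0, 1]`, interior, and `2m`-regular: `A` is smooth enough at
`a`, the derivatives of order `1, ..., 2m - 1` vanish there and the one of order `2m` is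
negative. -/
def IsRegularMaximizer (A : ℝ → ℝ) (m : ℕ) (a : ℝ) : Prop :=
  1 ≤ m ∧ a ∈ Ioo (0 : ℝ) 1 ∧ IsMaxOn A (Icc 0 1) a ∧ ContDiffAt ℝ ((2 * m : ℕ) : ℕ∞) A a ∧
    (∀ k : ℕ, 1 ≤ k → k ≤ 2 * m - 1 → iteratedDeriv k A a = 0) ∧ iteratedDeriv (2 * m) A a < 0

/-- The Wasserstein distance of two laws on `ℝ` with finite first moments: the supremum of
`|∫ g dμ - ∫ g dν|` over the `1`-Lipschitz functions `g`. -/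
def wassersteinDist (μ ν : Measure ℝ) : ℝ≥0∞ :=
  ⨆ (g : ℝ → ℝ) (_ : LipschitzWith 1 g), ENNReal.ofReal |∫ x, g x ∂μ - ∫ x, g x ∂ν|

/-- The event that the fraction of plus spins lies in `(a - δ, a + δ)`. -/
def nearEvent (n : ℕ) (a δ : ℝ) : Set (Config n) :=
  {ω | plusFraction ω ∈ Ioo (a - δ) (a + δ)}

/-- The probability law on `ℝ` with density proportional to `exp (A⁗(1/2) x ^ 4 / (2 ^ 4 * 4!))`. -/
def quarticLaw : Measure ℝ :=
  (volume : Measure ℝ).tilted fun x =>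
    iteratedDeriv 4 freeEnergy (1 / 2) * x ^ 4 / (2 ^ 4 * (Nat.factorial 4 : ℝ))

/-- The centered Gaussian law with variance `4 / |A''(0.95)|`. -/
def gaussianLaw : Measure ℝ :=
  gaussianReal 0 (Real.toNNReal (4 / |iteratedDeriv 2 freeEnergy (19 / 20)|))

end

end SixSpin

namespace SixSpin

/-! ### Comparison of lattice sums with integrals -/

/-! Everything depends on the number `k` of plus spins, whose Gibbs weight is `n.choose k * exp (n
f(k/n))`. By Stirling this is `exp (n A(k/n))` divided by `√(2πn a(1-a))`, up to a relative error
`O(1/n + |k/n - a|)` near an interior point `a`.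

Local limit. Let `a` be `2m`-regular, `N = n^(1/(2m))` and `x = 2N(k/n - a)`, which is the rescaled
magnetization. Taylor's formula gives `n(A(k/n) - A(a)) = -c x^(2m) + O(|x|^(2m+1)/N)`, so the
normalised weights differ from `exp (-c x^(2m))` by `O(e^(-2|x|)/N)` (`exists_levelWeight_approx`).
The points `x` form a lattice of mesh `2N/n ≤ 2/N`, so sums of Lipschitz functions over it are
integrals up to `O(1/N)` (`lattice_sum_sub_integral_le`). Dividing the sum for `g` by the sum for
`1` bounds the Wasserstein distance by `O(1/N)` (`exists_wassersteinDist_le`), that is `n^(-1/4)`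
for `m = 2` and `n^(-1/2)` for `m = 1`.

Shape of `A`. The two coefficients solve the linear system `A(0.95) = log 2 = A(1/2)`, `A'(0.95) =
0`. With `t = 2a - 1`, `A''` is `t²/(a(1-a))` times a quartic, negative for `-1 < t ≤ 0` and with
exactly two zeros in `t ≥ 0`, both below `0.9`. Hence `A` is strictly concave around each of the two
critical points `1/2` and `0.95` and convex in between, which leaves no other maximizer
(`freeEnergy_lt`).

Competition. Both maxima have height `log 2`, so the prefactor `√n/N` decides: the mass near `1/2`
is of order `n^(1/4) 2^n`, the mass near `0.95` of order `2^n`, and the rest is exponentially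
smaller than `2^n`. Thus `1/2` wins, with error `O(n^(-1/4))` (`exists_farSum_div_le`). -/

lemma abs_pow_mul_exp_neg_pow_le {c : ℝ} (hc : 0 < c) {m : ℕ} (hm : 1 ≤ m) (p : ℕ) :
    ∃ C : ℝ, 0 < C ∧ ∀ x : ℝ,
      |x| ^ p * Real.exp (-c * x ^ (2 * m)) ≤ C * Real.exp (-2 * |x|) := by
  refine ⟨p.factorial * Real.exp (c + 9 / (4 * c)), by positivity, fun x => ?_⟩
  have h1 : |x| ^ p ≤ p.factorial * Real.exp |x| := by
    have := Real.pow_div_factorial_le_exp |x| (abs_nonneg x) p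
    rwa [div_le_iff₀ (by positivity), mul_comm] at this
  have h2 : x ^ 2 - 1 ≤ x ^ (2 * m) := by
    rw [pow_mul]
    rcases le_total (x ^ 2) 1 with h | h
    · have : 0 ≤ (x ^ 2) ^ m := by positivity
      linarith
    · have : x ^ 2 ≤ (x ^ 2) ^ m := le_self_pow₀ h (by omega)
      linarith
  -- The rate 3 is 1 + 2: one unit absorbs the `exp |x|` of `h1`, two units are left for the
  -- conclusion.
  have h3 : 3 * |x| ≤ c * x ^ 2 + 9 / (4 * c) := by
    have h : 0 ≤ (2 * c * |x| - 3) ^ 2 / (4 * c) := by positivity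
    have : (2 * c * |x| - 3) ^ 2 / (4 * c) = c * |x| ^ 2 + 9 / (4 * c) - 3 * |x| := by
      field_simp; ring
    rw [sq_abs] at this
    linarith
  calc |x| ^ p * Real.exp (-c * x ^ (2 * m))
      ≤ (p.factorial * Real.exp |x|) * Real.exp (c + 9 / (4 * c) - 3 * |x|) := by
        gcongr
        nlinarith
    _ = p.factorial * Real.exp (c + 9 / (4 * c)) * Real.exp (-2 * |x|) := by
        rw [mul_assoc, mul_assoc, ← Real.exp_add, ← Real.exp_add]; ring_nf

lemma exp_neg_two_abs_le {x y : ℝ} (h : |x - y| ≤ 1) (r : ℝ) (hr : 0 ≤ r) :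
    Real.exp (-r * |y|) ≤ Real.exp r * Real.exp (-r * |x|) := by
  rw [← Real.exp_add]
  gcongr
  have : |x| ≤ |y| + |x - y| := by
    have := abs_add_le y (x - y); simpa using this
  nlinarith

lemma exp_neg_pow_lipschitz {c : ℝ} (hc : 0 < c) {m : ℕ} (hm : 1 ≤ m) :
    ∃ C : ℝ, 0 < C ∧ ∀ x y : ℝ, |x - y| ≤ 1 →
      |Real.exp (-c * x ^ (2 * m)) - Real.exp (-c * y ^ (2 * m))|
        ≤ C * |x - y| * Real.exp (-2 * |x|) := by
  obtain ⟨C, hC, h⟩ := abs_pow_mul_exp_neg_pow_le hc hm (2 * m - 1)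
  refine ⟨c * (2 * m : ℕ) * C * Real.exp 2, by positivity, fun x y hxy => ?_⟩
  have hd : ∀ z : ℝ, HasDerivAt (fun z => Real.exp (-c * z ^ (2 * m)))
      (Real.exp (-c * z ^ (2 * m)) * (-c * ((2 * m : ℕ) * z ^ (2 * m - 1)))) z := fun z =>
    ((hasDerivAt_pow (2 * m) z).const_mul (-c)).exp
  have := (convex_uIcc x y).norm_image_sub_le_of_norm_deriv_le
    (f := fun z => Real.exp (-c * z ^ (2 * m))) (x := y) (y := x)
    (C := c * (2 * m : ℕ) * C * Real.exp 2 * Real.exp (-2 * |x|))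
    (fun z _ => (hd z).differentiableAt) (fun z hz => ?_) right_mem_uIcc left_mem_uIcc
  · rw [Real.norm_eq_abs, Real.norm_eq_abs] at this
    linarith
  · rw [(hd z).deriv, Real.norm_eq_abs, abs_mul, Real.abs_exp, abs_mul, abs_neg, abs_of_pos hc,
      abs_mul, Nat.abs_cast, abs_pow]
    have hz' : |x - z| ≤ 1 := by
      refine le_trans ?_ hxy
      rw [abs_sub_comm x y, abs_sub_comm x z]
      exact abs_sub_left_of_mem_uIcc hz
    calc Real.exp (-c * z ^ (2 * m)) * (c * ((2 * m : ℕ) * |z| ^ (2 * m - 1)))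
        = c * (2 * m : ℕ) * (|z| ^ (2 * m - 1) * Real.exp (-c * z ^ (2 * m))) := by ring
      _ ≤ c * (2 * m : ℕ) * (C * (Real.exp 2 * Real.exp (-2 * |x|))) := by
          refine mul_le_mul_of_nonneg_left ((h z).trans ?_) (by positivity)
          gcongr
          exact exp_neg_two_abs_le hz' 2 (by norm_num)
      _ = _ := by ring

lemma integrable_exp_neg_mul_abs {r : ℝ} (hr : 0 < r) :
    Integrable fun x : ℝ => Real.exp (-r * |x|) := by
  have h : IntegrableOn (fun x : ℝ => Real.exp (-r * x)) (Ioi 0) := exp_neg_integrableOn_Ioi 0 hr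
  rw [← integrableOn_univ, ← Iic_union_Ioi (a := (0 : ℝ)), integrableOn_union]
  constructor
  · rw [integrableOn_Iic_iff_integrableOn_Iio]
    have h' : IntegrableOn (fun x : ℝ => Real.exp (-r * -x)) (Iio 0) :=
      IntegrableOn.comp_neg_Iio (c := (0 : ℝ)) (f := fun x : ℝ => Real.exp (-r * x)) (by simpa using h)
    refine h'.congr_fun (fun x hx => ?_) measurableSet_Iio
    simp only [abs_of_neg (show x < 0 from hx)]
  · refine h.congr_fun (fun x hx => ?_) measurableSet_Ioi
    simp only [abs_of_pos (show (0 : ℝ) < x from hx)]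

/-- This is why the envelope has rate 2: one unit pays for the linear growth of `g`, through `|g x|
≤ (|g 0| + 1) exp |x|`, and the other is integrable. -/
lemma integrable_lipschitz_mul {C : ℝ} {φ g : ℝ → ℝ}
    (hφ : ∀ x, |φ x| ≤ C * Real.exp (-2 * |x|)) (hφc : Continuous φ) (hg : LipschitzWith 1 g) :
    Integrable fun x => g x * φ x := by
  have hI := integrable_exp_neg_mul_abs one_pos
  have hC : 0 ≤ C := by simpa using (abs_nonneg _).trans (hφ 0)
  refine (hI.const_mul ((|g 0| + 1) * C)).mono' (hg.continuous.mul hφc).aestronglyMeasurable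
    (Eventually.of_forall fun x => ?_)
  have h1 : |g x| ≤ (|g 0| + 1) * Real.exp |x| := by
    have h1 : |g x - g 0| ≤ |x| := by simpa [Real.dist_eq] using hg.dist_le_mul x 0
    have h2 := abs_add_le (g x - g 0) (g 0)
    rw [sub_add_cancel] at h2
    nlinarith [Real.add_one_le_exp |x|, abs_nonneg (g 0), abs_nonneg x]
  rw [Real.norm_eq_abs, abs_mul]
  calc |g x| * |φ x| ≤ ((|g 0| + 1) * Real.exp |x|) * (C * Real.exp (-2 * |x|)) := by
        gcongr
        exact hφ x
    _ = (|g 0| + 1) * C * (Real.exp |x| * Real.exp (-2 * |x|)) := by ring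
    _ = (|g 0| + 1) * C * Real.exp (-1 * |x|) := by rw [← Real.exp_add]; ring_nf

/-- A lattice sum becomes the integral of a step function, constant on cells of length `η` whose
left ends are the lattice points `η (j - b)`. Sum and integral can then be compared pointwise under
one integral sign. -/
lemma integral_floor {η : ℝ} (hη : 0 < η) (b : ℝ) (S : Finset ℤ) (F : ℤ → ℝ)
    (hF : ∀ j, j ∉ S → F j = 0) :
    Integrable (fun x : ℝ => F ⌊x / η + b⌋) ∧
      ∫ x : ℝ, F ⌊x / η + b⌋ = η * ∑ j ∈ S, F j := by
  have hrep : (fun y : ℝ => F ⌊y⌋) =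
      fun y => ∑ j ∈ S, (Ico (j : ℝ) (j + 1)).indicator (fun _ => F j) y := by
    funext y
    have : ∀ j : ℤ, (Ico (j : ℝ) (j + 1)).indicator (fun _ => F j) y
        = if j = ⌊y⌋ then F ⌊y⌋ else 0 := by
      intro j
      by_cases hj : j = ⌊y⌋
      · subst hj
        simp [Int.floor_le, Int.lt_floor_add_one]
      · rw [indicator_of_notMem, if_neg hj]
        rintro ⟨h1, h2⟩
        exact hj (Int.floor_eq_iff.2 ⟨h1, h2⟩).symm
    simp only [this, Finset.sum_ite_eq']
    split_ifs with h
    · rfl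
    · exact hF _ h
  have hint : ∀ j ∈ S, Integrable ((Ico (j : ℝ) (j + 1)).indicator fun _ => F j) := fun j _ =>
    (integrable_indicator_iff measurableSet_Ico).2 (by simp [integrableOn_const_iff])
  have hi : Integrable (fun y : ℝ => F ⌊y⌋) := by
    rw [hrep]; exact integrable_finsetSum _ hint
  refine ⟨?_, ?_⟩
  · exact (hi.comp_add_right b).comp_div hη.ne'
  · have h1 := Measure.integral_comp_div (fun y => F ⌊y + b⌋) η
    rw [h1, integral_add_right_eq_self (fun y => F ⌊y⌋), hrep, integral_finsetSum _ hint,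
      abs_of_pos hη, smul_eq_mul]
    congr 1
    refine Finset.sum_congr rfl fun j _ => ?_
    rw [integral_indicator measurableSet_Ico]
    simp

/-- A lattice sum of a function of at most unit slope, against weights close to a rapidly
decreasing density, is close to the corresponding integral. -/
lemma lattice_sum_sub_integral_le {C ε η b : ℝ} (hC : 0 < C) (hε : 0 ≤ ε) (hη : 0 < η)
    (hη1 : η ≤ 1) (S : Finset ℤ) (W : ℤ → ℝ) (hS : ∀ j, j ∉ S → W j = 0) {φ g : ℝ → ℝ}
    (hφ : ∀ x, |φ x| ≤ C * Real.exp (-2 * |x|)) (hφc : Continuous φ)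
    (hφl : ∀ x y, |x - y| ≤ 1 → |φ x - φ y| ≤ C * |x - y| * Real.exp (-2 * |x|))
    (hW : ∀ j : ℤ, |W j - φ (η * (j - b))| ≤ C * ε * Real.exp (-2 * |η * (j - b)|))
    (hg : LipschitzWith 1 g) (hg0 : |g 0| ≤ 1) :
    |η * ∑ j ∈ S, g (η * (j - b)) * W j - ∫ x, g x * φ x|
      ≤ (2 * C * Real.exp 1 * ∫ x : ℝ, Real.exp (-1 * |x|)) * (ε + η) := by
  have hgl : ∀ x y, |g x - g y| ≤ |x - y| := fun x y => by
    simpa [Real.dist_eq] using hg.dist_le_mul x y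
  have hgb : ∀ x, |g x| ≤ 1 + |x| := fun x => by
    have h1 := hgl x 0
    have h2 := abs_add_le (g x - g 0) (g 0)
    simp only [sub_add_cancel, sub_zero] at h1 h2
    linarith
  have hge : ∀ x, |g x| * Real.exp (-2 * |x|) ≤ Real.exp (-1 * |x|) := fun x => by
    calc |g x| * Real.exp (-2 * |x|) ≤ Real.exp |x| * Real.exp (-2 * |x|) := by
          gcongr
          linarith [hgb x, Real.add_one_le_exp |x|]
      _ = Real.exp (-1 * |x|) := by rw [← Real.exp_add]; ring_nf
  have hI := integrable_exp_neg_mul_abs one_pos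
  have hgφ := integrable_lipschitz_mul hφ hφc hg
  obtain ⟨hFi, hFe⟩ := integral_floor hη b S (fun j => g (η * (j - b)) * W j)
    (fun j hj => by simp [hS j hj])
  rw [← hFe, ← integral_sub hFi hgφ, ← Real.norm_eq_abs]
  have hpt : ∀ x : ℝ, ‖g (η * (⌊x / η + b⌋ - b)) * W ⌊x / η + b⌋ - g x * φ x‖
      ≤ (2 * C * Real.exp 1 * (ε + η)) * Real.exp (-1 * |x|) := by
    intro x
    set j := ⌊x / η + b⌋ with hj
    set y := η * (j - b) with hy
    have hxy : |x - y| ≤ η := by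
      have h1 := Int.floor_le (x / η + b)
      have h2 := Int.lt_floor_add_one (x / η + b)
      rw [← hj] at h1 h2
      have e : x - y = η * (x / η + b - j) := by rw [hy]; field_simp; ring
      rw [e, abs_of_nonneg (mul_nonneg hη.le (by linarith))]
      nlinarith
    have hxy1 := hxy.trans hη1
    have hyx1 : |y - x| ≤ 1 := by rwa [abs_sub_comm]
    have e1 : Real.exp (-1 * |y|) ≤ Real.exp 1 * Real.exp (-1 * |x|) :=
      exp_neg_two_abs_le hxy1 1 zero_le_one
    have e2 : Real.exp (-2 * |x|) ≤ Real.exp 1 * Real.exp (-1 * |x|) := by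
      rw [← Real.exp_add]; gcongr; linarith [abs_nonneg x]
    -- Three errors: weight against density at the lattice point `y` (order `ε`), then moving `φ`
    -- and moving `g` from `y` to `x` (order `η` each).
    have t1 : |g y| * |W j - φ y| ≤ C * ε * (Real.exp 1 * Real.exp (-1 * |x|)) :=
      calc |g y| * |W j - φ y| ≤ |g y| * (C * ε * Real.exp (-2 * |y|)) := by
            gcongr; exact hW j
        _ = C * ε * (|g y| * Real.exp (-2 * |y|)) := by ring
        _ ≤ _ := mul_le_mul_of_nonneg_left ((hge y).trans e1) (by positivity)
    have t2 : |g y| * |φ y - φ x| ≤ C * η * (Real.exp 1 * Real.exp (-1 * |x|)) :=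
      calc |g y| * |φ y - φ x| ≤ |g y| * (C * |y - x| * Real.exp (-2 * |y|)) := by
            gcongr; exact hφl y x hyx1
        _ = C * |y - x| * (|g y| * Real.exp (-2 * |y|)) := by ring
        _ ≤ C * η * (Real.exp 1 * Real.exp (-1 * |x|)) := by
            refine mul_le_mul ?_ ((hge y).trans e1) (by positivity) (by positivity)
            refine mul_le_mul_of_nonneg_left ?_ hC.le
            rwa [abs_sub_comm]
    have t3 : |g y - g x| * |φ x| ≤ η * (C * (Real.exp 1 * Real.exp (-1 * |x|))) := by
      gcongr
      · exact (hgl y x).trans (by rwa [abs_sub_comm])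
      · exact (hφ x).trans (by gcongr)
    have e : g y * W j - g x * φ x = g y * (W j - φ y) + g y * (φ y - φ x) + (g y - g x) * φ x := by
      ring
    rw [Real.norm_eq_abs, e]
    refine (abs_add_three _ _ _).trans ?_
    rw [abs_mul, abs_mul, abs_mul]
    have : 0 ≤ C * ε * (Real.exp 1 * Real.exp (-1 * |x|)) := by positivity
    linarith
  refine (norm_integral_le_of_norm_le (hI.const_mul _) (Eventually.of_forall hpt)).trans_eq ?_
  rw [integral_const_mul]
  ring

/-! ### Binomial coefficients -/

open Stirling in
-- The decrement of `log (stirlingSeq j)` is at most `1/(12 j (j+1))`, which telescopes. So `log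
-- (stirlingSeq j) - 1/(12 j)` increases to its limit `log √π`.
lemma stirlingSeq_le {k : ℕ} (hk : 1 ≤ k) :
    stirlingSeq k ≤ √Real.pi * Real.exp (1 / (12 * k)) := by
  have hpos : ∀ j : ℕ, 0 < stirlingSeq (j + 1) := stirlingSeq'_pos
  have hmono : Monotone fun j : ℕ => Real.log (stirlingSeq (j + 1)) - 1 / (12 * (j + 1 : ℕ)) := by
    refine monotone_nat_of_le_succ fun j => ?_
    have h := log_stirlingSeq_sdiff_le (j + 1)
    have e : (1 : ℝ) / (12 * (j + 1 : ℕ) * ((j + 1 : ℕ) + 1))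
        = 1 / (12 * (j + 1 : ℕ)) - 1 / (12 * (j + 1 + 1 : ℕ)) := by
      push_cast; field_simp; ring
    rw [e] at h
    linarith
  have hlim : Tendsto (fun j : ℕ => Real.log (stirlingSeq (j + 1)) - 1 / (12 * (j + 1 : ℕ)))
      atTop (𝓝 (Real.log √Real.pi - 0)) := by
    refine Tendsto.sub ?_ ?_
    · exact ((tendsto_add_atTop_iff_nat 1).2 tendsto_stirlingSeq_sqrt_pi).log (by positivity)
    · refine (tendsto_add_atTop_iff_nat (f := fun j : ℕ => (1 : ℝ) / (12 * j)) 1).2 ?_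
      exact tendsto_const_nhds.div_atTop
        (tendsto_natCast_atTop_atTop.const_mul_atTop (by norm_num))
  obtain ⟨j, rfl⟩ : ∃ j, k = j + 1 := ⟨k - 1, by omega⟩
  have h := hmono.ge_of_tendsto hlim j
  rw [sub_zero, sub_le_iff_le_add, Real.log_le_iff_le_exp (hpos j), Real.exp_add,
    Real.exp_log (by positivity)] at h
  exact h

lemma exp_neg_mul_binEntropy {n k : ℕ} (hn : 0 < n) (hk : k ≤ n) :
    Real.exp (-(n * Real.binEntropy (k / n))) = (k / n : ℝ) ^ k * (1 - k / n : ℝ) ^ (n - k) := by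
  have hn' : (n : ℝ) ≠ 0 := by positivity
  -- The case `j = 0` covers the endpoints `k = 0` and `k = n`: both sides are 1 because `0 ^ 0 =
  -- 1`.
  have key : ∀ j : ℕ, Real.exp (j * Real.log (j / n)) = (j / n : ℝ) ^ j := fun j => by
    rcases Nat.eq_zero_or_pos j with rfl | hj
    · simp
    · rw [mul_comm, Real.exp_mul, Real.exp_log (by positivity), Real.rpow_natCast]
  have e : (1 - k / n : ℝ) = ((n - k : ℕ) : ℝ) / n := by rw [Nat.cast_sub hk]; field_simp
  rw [e, ← key, ← key, ← Real.exp_add, Real.binEntropy, e, Real.log_inv, Real.log_inv]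
  congr 1
  field_simp
  ring

/-- A single term of the expansion of `(p + (1 - p))^n = 1` at `p = k/n` is at most 1. Unlike the
Stirling form this is uniform up to the endpoints, which the bound far from the maximizers needs. -/
lemma choose_le_exp_binEntropy {n k : ℕ} (hn : 0 < n) (hk : k ≤ n) :
    (n.choose k : ℝ) ≤ Real.exp (n * Real.binEntropy (k / n)) := by
  have h := exp_neg_mul_binEntropy hn hk
  have hp : (0 : ℝ) ≤ k / n := by positivity
  have hq : (0 : ℝ) ≤ 1 - k / n := by
    rw [sub_nonneg, div_le_one (by positivity)]; exact_mod_cast hk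
  have hs := add_pow (k / n : ℝ) (1 - k / n) n
  rw [add_sub_cancel, one_pow] at hs
  have h1 : (k / n : ℝ) ^ k * (1 - k / n : ℝ) ^ (n - k) * n.choose k ≤ 1 := by
    refine le_of_le_of_eq ?_ hs.symm
    exact Finset.single_le_sum
      (f := fun m => (k / n : ℝ) ^ m * (1 - k / n : ℝ) ^ (n - m) * n.choose m)
      (fun i _ => by positivity) (Finset.mem_range.2 (Nat.lt_succ_of_le hk))
  rw [← h, Real.exp_neg, inv_mul_le_iff₀ (Real.exp_pos _), mul_one] at h1
  exact h1

open Stirling in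
-- An exact identity: the whole error of Stirling's formula sits in the quotient of `stirlingSeq`
-- values.
lemma choose_eq_stirling {n k : ℕ} (hk : 0 < k) (hkn : k < n) :
    (n.choose k : ℝ) * √(2 * Real.pi * n * ((k / n : ℝ) * (1 - k / n))) =
      √Real.pi * stirlingSeq n / (stirlingSeq k * stirlingSeq (n - k))
        * Real.exp (n * Real.binEntropy (k / n)) := by
  have hn : 0 < n := hk.trans hkn
  obtain ⟨l, rfl⟩ : ∃ l, n = k + l := ⟨n - k, by omega⟩
  have hl : 0 < l := by omega
  have h := exp_neg_mul_binEntropy hn hkn.le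
  rw [Real.exp_neg] at h
  rw [← inv_inv (Real.exp _), h, Nat.add_sub_cancel_left, Nat.cast_add_choose]
  have e : (1 - k / (k + l : ℕ) : ℝ) = (l : ℝ) / (k + l : ℕ) := by push_cast; field_simp; ring
  rw [e]
  have hfac : ∀ j : ℕ, 0 < j → (j.factorial : ℝ) = stirlingSeq j * (√(2 * j) * (j / Real.exp 1) ^ j) := by
    intro j hj
    rw [stirlingSeq, div_mul_cancel₀]
    positivity
  have hs : ∀ j : ℕ, 0 < j → 0 < stirlingSeq j := fun j hj => by
    obtain ⟨i, rfl⟩ : ∃ i, j = i + 1 := ⟨j - 1, by omega⟩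
    exact stirlingSeq'_pos i
  have h1 := hs k hk
  have h2 := hs l hl
  rw [hfac _ hn, hfac _ hk, hfac _ hl]
  have hsq : √(2 * Real.pi * (k + l : ℕ) * ((k / (k + l : ℕ) : ℝ) * (l / (k + l : ℕ))))
      * √(2 * (k + l : ℕ)) = √Real.pi * (√(2 * k) * √(2 * l)) := by
    rw [← Real.sqrt_mul (by positivity), ← Real.sqrt_mul (by positivity),
      ← Real.sqrt_mul (by positivity)]
    congr 1
    push_cast
    field_simp
  have hk2 : √(2 * (k : ℝ)) ≠ 0 := by positivity
  have hl2 : √(2 * (l : ℝ)) ≠ 0 := by positivity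
  generalize √(2 * Real.pi * (k + l : ℕ) * ((k / (k + l : ℕ) : ℝ) * (l / (k + l : ℕ)))) = Q at *
  generalize √(2 * ((k + l : ℕ) : ℝ)) = R at *
  simp only [div_pow, pow_add]
  field_simp
  linear_combination Stirling.stirlingSeq (k + l) * hsq

/-- The local form of the de Moivre-Laplace approximation of a binomial coefficient. -/
lemma exists_choose_approx {a₀ : ℝ} (h0 : 0 < a₀) (h1 : a₀ < 1) :
    ∃ C : ℝ, 0 < C ∧ ∀ n k : ℕ, 0 < n → k ≤ n → |(k / n : ℝ) - a₀| ≤ a₀ / 2 →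
      |(k / n : ℝ) - a₀| ≤ (1 - a₀) / 2 →
      ∃ θ : ℝ, |θ - 1| ≤ C * (1 / n + |(k / n : ℝ) - a₀|) ∧
        (n.choose k : ℝ) * √(2 * Real.pi * n * (a₀ * (1 - a₀)))
          = θ * Real.exp (n * Real.binEntropy (k / n)) := by
  have h1' : 0 < 1 - a₀ := by linarith
  -- A lower bound for `a (1 - a)`, since `a ≥ a₀/2` and `1 - a ≥ (1 - a₀)/2` in the allowed range.
  set κ := a₀ * (1 - a₀) / 4 with hκ
  have hκ0 : 0 < κ := by positivity
  refine ⟨(1 + 1 / κ) * (1 / κ), by positivity, fun n k hn hk ha hb => ?_⟩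
  have hn' : (0 : ℝ) < n := by positivity
  set a : ℝ := k / n with hadef
  have ha1 : a₀ / 2 ≤ a := by linarith [(abs_le.1 ha).1]
  have hb1 : (1 - a₀) / 2 ≤ 1 - a := by linarith [(abs_le.1 hb).2]
  have ha0 : 0 < a := by linarith
  have hb0 : 0 < 1 - a := by linarith
  have hκa : κ ≤ a * (1 - a) := by
    have := mul_le_mul ha1 hb1 (by positivity) ha0.le
    linarith
  have hak : a * n = k := by rw [hadef]; field_simp
  have hk0 : 0 < k := by
    have : (0 : ℝ) < k := by rw [← hak]; positivity
    exact_mod_cast this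
  have hkn : k < n := by
    have : (k : ℝ) < n := by rw [← hak]; nlinarith
    exact_mod_cast this
  have hst := choose_eq_stirling hk0 hkn
  rw [← hadef] at hst
  set ρ := √Real.pi * Stirling.stirlingSeq n
    / (Stirling.stirlingSeq k * Stirling.stirlingSeq (n - k)) with hρ
  set r := √(a₀ * (1 - a₀) / (a * (1 - a))) with hr
  -- `ρ` is the Stirling correction, `1 + O(1/n)`. `r` comes from freezing the variance `a (1 - a)`
  -- at `a₀` and is `1 + O(|a - a₀|)`.
  refine ⟨ρ * r, ?_, ?_⟩
  swap
  · have : √(2 * Real.pi * n * (a₀ * (1 - a₀))) = √(2 * Real.pi * n * (a * (1 - a))) * r := by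
      rw [hr, ← Real.sqrt_mul (by positivity)]
      congr 1
      field_simp
    rw [this]
    linear_combination r * hst
  have hr0 : 0 ≤ r := Real.sqrt_nonneg _
  have hr1 : |r - 1| ≤ 1 / κ * |a - a₀| := by
    have hr2 : r ^ 2 = a₀ * (1 - a₀) / (a * (1 - a)) := Real.sq_sqrt (by positivity)
    have e : r ^ 2 - 1 = (a₀ - a) * (1 - a - a₀) / (a * (1 - a)) := by
      rw [hr2]; field_simp; ring
    have h3 : |r - 1| ≤ |r ^ 2 - 1| := by
      have : r ^ 2 - 1 = (r - 1) * (r + 1) := by ring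
      rw [this, abs_mul, abs_of_pos (show 0 < r + 1 by linarith)]
      nlinarith [abs_nonneg (r - 1)]
    refine h3.trans ?_
    rw [e, abs_div, abs_mul, abs_of_pos (mul_pos ha0 hb0), abs_sub_comm, div_eq_inv_mul,
      one_div]
    have h4 : |1 - a - a₀| ≤ 1 := abs_le.2 ⟨by linarith, by linarith⟩
    gcongr
    nlinarith [abs_nonneg (a - a₀)]
  have hρ1 : |ρ - 1| ≤ 1 / κ * (1 / n) := by
    have hl : 0 < n - k := by omega
    have hsum : 1 / (k : ℝ) + 1 / ((n - k : ℕ) : ℝ) ≤ 1 / κ * (1 / n) := by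
      have e : 1 / (k : ℝ) + 1 / ((n - k : ℕ) : ℝ) = 1 / (a * (1 - a)) * (1 / n) := by
        rw [Nat.cast_sub hk, ← hak]
        have : (n : ℝ) - a * n = (1 - a) * n := by ring
        rw [this]
        field_simp
        ring
      rw [e]
      gcongr
    have hsk := Stirling.sqrt_pi_le_stirlingSeq hk0.ne'
    have hsl := Stirling.sqrt_pi_le_stirlingSeq hl.ne'
    have hsn := Stirling.sqrt_pi_le_stirlingSeq hn.ne'
    have huk := stirlingSeq_le hk0
    have hul := stirlingSeq_le hl
    have hun := stirlingSeq_le hn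
    have hpi : 0 < √Real.pi := by positivity
    have hk0' : (0 : ℝ) < k := by positivity
    have hl0' : (0 : ℝ) < (n - k : ℕ) := by positivity
    have hden : 0 < Stirling.stirlingSeq k * Stirling.stirlingSeq (n - k) :=
      mul_pos (hpi.trans_le hsk) (hpi.trans_le hsl)
    refine le_trans ?_ hsum
    rw [abs_le]
    constructor
    · have : Real.exp (-(1 / (12 * k) + 1 / (12 * (n - k : ℕ)))) ≤ ρ := by
        rw [hρ, le_div_iff₀ hden, Real.exp_neg, inv_mul_le_iff₀ (Real.exp_pos _), Real.exp_add]
        calc _ ≤ (√Real.pi * Real.exp (1 / (12 * k))) *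
              (√Real.pi * Real.exp (1 / (12 * (n - k : ℕ)))) :=
              mul_le_mul huk hul (hpi.trans_le hsl).le (by positivity)
          _ = Real.exp (1 / (12 * k)) * Real.exp (1 / (12 * (n - k : ℕ)))
              * (√Real.pi * √Real.pi) := by ring
          _ ≤ _ := by gcongr
      have h5 := Real.add_one_le_exp (-(1 / (12 * k) + 1 / (12 * (n - k : ℕ))) : ℝ)
      have h6 : 1 / (12 * (k : ℝ)) ≤ 1 / k := by gcongr; linarith
      have h7 : 1 / (12 * ((n - k : ℕ) : ℝ)) ≤ 1 / (n - k : ℕ) := by gcongr; linarith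
      linarith
    · have : ρ ≤ Real.exp (1 / (12 * n)) := by
        rw [hρ, div_le_iff₀ hden]
        calc _ ≤ √Real.pi * (√Real.pi * Real.exp (1 / (12 * n))) := by gcongr
          _ = Real.exp (1 / (12 * n)) * (√Real.pi * √Real.pi) := by ring
          _ ≤ _ := mul_le_mul_of_nonneg_left
              (mul_le_mul hsk hsl hpi.le (hpi.trans_le hsk).le) (Real.exp_pos _).le
      have hn1 : (1 : ℝ) ≤ n := by exact_mod_cast hn
      have h5 : Real.exp (1 / (12 * n)) ≤ 1 + 2 * (1 / (12 * n)) := by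
        have hx : (1 : ℝ) / (12 * n) ≤ 1 := by
          rw [div_le_one (by positivity)]; linarith
        have := Real.abs_exp_sub_one_le (x := 1 / (12 * (n : ℝ)))
          (by rwa [abs_of_nonneg (by positivity)])
        rw [abs_of_nonneg (show (0 : ℝ) ≤ 1 / (12 * n) by positivity)] at this
        linarith [le_abs_self (Real.exp (1 / (12 * n)) - 1)]
      have h6 : 2 * (1 / (12 * (n : ℝ))) ≤ 1 / k := by
        have : 2 * (1 / (12 * (n : ℝ))) = 1 / (6 * n) := by field_simp; norm_num
        rw [this]
        gcongr
        have : (k : ℝ) ≤ n := by exact_mod_cast hk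
        linarith
      have h7 : 0 ≤ 1 / ((n - k : ℕ) : ℝ) := by positivity
      linarith
  have hr2 : r ≤ 1 + 1 / κ := by
    have h3 : |a - a₀| ≤ 1 := by linarith
    have h4 := le_abs_self (r - 1)
    have : 1 / κ * |a - a₀| ≤ 1 / κ * 1 := by gcongr
    linarith
  have e : ρ * r - 1 = (ρ - 1) * r + (r - 1) := by ring
  have hik : 0 < 1 / κ := by positivity
  calc |ρ * r - 1| ≤ |ρ - 1| * r + |r - 1| := by
        rw [e]
        refine (abs_add_le _ _).trans ?_
        rw [abs_mul, abs_of_nonneg hr0]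
    _ ≤ (1 / κ * (1 / n)) * (1 + 1 / κ) + 1 / κ * |a - a₀| := by gcongr
    _ ≤ (1 + 1 / κ) * (1 / κ) * (1 / n + |a - a₀|) := by
        have : 0 ≤ 1 / κ * (1 / κ) * |a - a₀| := by positivity
        nlinarith

/-! ### Local asymptotics at a regular maximizer -/

lemma abs_exp_sub_exp_le {u v w : ℝ} (hu : u ≤ w) (hv : v ≤ w) :
    |Real.exp u - Real.exp v| ≤ |u - v| * Real.exp w := by
  wlog h : v ≤ u generalizing u v
  · rw [abs_sub_comm, abs_sub_comm u v]
    exact this hv hu (le_of_not_ge h)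
  rw [abs_of_nonneg (sub_nonneg.2 (Real.exp_le_exp.2 h)), abs_of_nonneg (sub_nonneg.2 h)]
  have h1 : Real.exp v = Real.exp u * Real.exp (v - u) := by rw [← Real.exp_add]; ring_nf
  have h2 := Real.add_one_le_exp (v - u)
  calc Real.exp u - Real.exp v = Real.exp u * (1 - Real.exp (v - u)) := by rw [h1]; ring
    _ ≤ Real.exp u * (u - v) := mul_le_mul_of_nonneg_left (by linarith) (Real.exp_pos u).le
    _ ≤ (u - v) * Real.exp w := by
        rw [mul_comm]
        have := sub_nonneg.2 h
        gcongr

lemma exists_taylor_bound {A : ℝ → ℝ} {a : ℝ} (hA : AnalyticAt ℝ A a) {p : ℕ} (hp : 1 ≤ p)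
    (hd : ∀ k : ℕ, 1 ≤ k → k ≤ p - 1 → iteratedDeriv k A a = 0) :
    ∃ C s₀ : ℝ, 0 < C ∧ 0 < s₀ ∧ ∀ s : ℝ, |s| < s₀ →
      |A (a + s) - A a - iteratedDeriv p A a / p.factorial * s ^ p| ≤ C * |s| ^ (p + 1) := by
  obtain ⟨C, hC, h⟩ := (hA.hasFPowerSeriesAt.isBigO_sub_partialSum_pow (p + 1)).exists_pos
  rw [Asymptotics.isBigOWith_iff, Metric.eventually_nhds_iff] at h
  obtain ⟨s₀, hs₀, h⟩ := h
  refine ⟨C, s₀, hC, hs₀, fun s hs => ?_⟩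
  have h1 := h (y := s) (by simpa using hs)
  rw [norm_pow, norm_norm, Real.norm_eq_abs, Real.norm_eq_abs] at h1
  convert h1 using 2
  obtain ⟨q, rfl⟩ : ∃ q, p = q + 1 := ⟨p - 1, by omega⟩
  rw [FormalMultilinearSeries.partialSum, Finset.sum_range_succ, Finset.sum_range_succ',
    Finset.sum_eq_zero]
  · simp [FormalMultilinearSeries.ofScalars]
    ring
  · intro i hi
    rw [Finset.mem_range] at hi
    simp [FormalMultilinearSeries.ofScalars, hd (i + 1) (by omega) (by omega)]

/-- The fluctuation scale `n ^ (1 / (2 m))`. -/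
noncomputable def fluctScale (m n : ℕ) : ℝ := (n : ℝ) ^ (1 / (2 * m : ℝ))

lemma fluctScale_pos {m n : ℕ} (hn : 0 < n) : 0 < fluctScale m n := by
  unfold fluctScale; positivity

lemma one_le_fluctScale {m n : ℕ} (hn : 0 < n) : 1 ≤ fluctScale m n :=
  Real.one_le_rpow (by exact_mod_cast hn) (by positivity)

lemma fluctScale_pow {m n : ℕ} (hm : 1 ≤ m) : fluctScale m n ^ (2 * m) = n := by
  have : (m : ℝ) ≠ 0 := by positivity
  rw [fluctScale, ← Real.rpow_natCast, ← Real.rpow_mul (by positivity)]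
  push_cast
  rw [one_div, inv_mul_cancel₀ (by positivity), Real.rpow_one]

lemma fluctScale_sq_le {m n : ℕ} (hm : 1 ≤ m) (hn : 0 < n) : fluctScale m n ^ 2 ≤ n := by
  rw [← fluctScale_pow hm]
  exact pow_le_pow_right₀ (one_le_fluctScale hn) (by omega)

lemma fluctScale_le {m n : ℕ} (hm : 1 ≤ m) (hn : 0 < n) : fluctScale m n ≤ n := by
  have h1 := one_le_fluctScale (m := m) hn
  nlinarith [fluctScale_sq_le hm hn]

lemma tendsto_fluctScale {m : ℕ} (hm : 1 ≤ m) : Tendsto (fluctScale m) atTop atTop :=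
  (tendsto_rpow_atTop (by positivity)).comp tendsto_natCast_atTop_atTop

/-- The total Gibbs weight of the configurations with `k` plus spins. -/
noncomputable def levelWeight (f : ℝ → ℝ) (n k : ℕ) : ℝ := n.choose k * Real.exp (n * f (k / n))

/-- The normalisation of the level weights near the maximizer `a`. -/
noncomputable def levelScale (f : ℝ → ℝ) (a : ℝ) (n : ℕ) : ℝ :=
  Real.exp (n * (f a + Real.binEntropy a)) / √(2 * Real.pi * n * (a * (1 - a)))

/-- The coefficient of the limiting density `exp (-c x ^ (2 m))` at the maximizer `a`. -/
noncomputable def decayRate (f : ℝ → ℝ) (m : ℕ) (a : ℝ) : ℝ :=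
  -(iteratedDeriv (2 * m) (fun a => f a + Real.binEntropy a) a / (2 ^ (2 * m) * (2 * m).factorial))

lemma levelWeight_nonneg (f : ℝ → ℝ) (n k : ℕ) : 0 ≤ levelWeight f n k := by
  unfold levelWeight; positivity

lemma levelScale_pos (f : ℝ → ℝ) {a : ℝ} (h0 : 0 < a) (h1 : a < 1) {n : ℕ} (hn : 0 < n) :
    0 < levelScale f a n := by
  have : 0 < 1 - a := by linarith
  unfold levelScale; positivity

/-- The local limit theorem level by level. The factor 2 in `x = 2N(k/n - a)` makes `x` the rescaled
magnetization and is matched by the `2^(2m)` in `decayRate`. The Stirling error `1/n + |s|` and the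
Taylor error `C₁ |x|^(2m+1)/N` are both `1/N` times a polynomial in `|x|`. Half of the exponent `-c
x^(2m)` absorbs that polynomial and still leaves `exp (-2|x|)`. -/
lemma exists_levelWeight_approx {f : ℝ → ℝ} {m : ℕ} {a : ℝ} (hm : 1 ≤ m) (h0 : 0 < a) (h1 : a < 1)
    (hA : AnalyticAt ℝ (fun a => f a + Real.binEntropy a) a)
    (hd : ∀ k : ℕ, 1 ≤ k → k ≤ 2 * m - 1 →
      iteratedDeriv k (fun a => f a + Real.binEntropy a) a = 0)
    (hc : 0 < decayRate f m a) :
    ∃ δ₀ C : ℝ, 0 < δ₀ ∧ δ₀ ≤ a ∧ δ₀ ≤ 1 - a ∧ 0 < C ∧ ∀ n k : ℕ, 0 < n → k ≤ n →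
      |(k / n : ℝ) - a| < δ₀ →
      |levelWeight f n k / levelScale f a n
          - Real.exp (-decayRate f m a * (2 * fluctScale m n * (k / n - a)) ^ (2 * m))|
        ≤ C * (1 / fluctScale m n) * Real.exp (-2 * |2 * fluctScale m n * (k / n - a)|) := by
  have h1' : 0 < 1 - a := by linarith
  set c := decayRate f m a with hcdef
  set A : ℝ → ℝ := fun a => f a + Real.binEntropy a with hAdef
  obtain ⟨C₁, s₀, hC₁, hs₀, hT⟩ := exists_taylor_bound hA (p := 2 * m) (by omega) hd
  obtain ⟨C₂, hC₂, hθ⟩ := exists_choose_approx h0 h1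
  obtain ⟨D₀, hD₀, hE₀⟩ := abs_pow_mul_exp_neg_pow_le (half_pos hc) hm 0
  obtain ⟨D₁, hD₁, hE₁⟩ := abs_pow_mul_exp_neg_pow_le (half_pos hc) hm 1
  obtain ⟨D₂, hD₂, hE₂⟩ := abs_pow_mul_exp_neg_pow_le (half_pos hc) hm (2 * m + 1)
  -- `a/2` and `(1 - a)/2` serve the binomial estimate and `s₀` is the Taylor radius. Below
  -- `c/(2C₁)` the Taylor remainder is at most half of `c x^(2m)`, which gives `u ≤ v/2`.
  refine ⟨min (min (a / 2) ((1 - a) / 2)) (min s₀ (c / (2 * C₁))), C₂ * (D₀ + D₁) + C₁ * D₂,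
    by positivity, ?_, ?_, by positivity, fun n k hn hk hs => ?_⟩
  · exact ((min_le_left _ _).trans (min_le_left _ _)).trans (by linarith)
  · exact ((min_le_left _ _).trans (min_le_right _ _)).trans (by linarith)
  obtain ⟨hsa, hsb, hsc, hsd⟩ : |(k / n : ℝ) - a| < a / 2 ∧ |(k / n : ℝ) - a| < (1 - a) / 2 ∧
      |(k / n : ℝ) - a| < s₀ ∧ |(k / n : ℝ) - a| < c / (2 * C₁) := by
    simpa [and_assoc] using hs
  obtain ⟨θ, hθ1, hθ2⟩ := hθ n k hn hk hsa.le hsb.le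
  have hN := fluctScale_pos (m := m) hn
  have hNp := fluctScale_pow (n := n) hm
  have hNn := fluctScale_le hm hn
  set N := fluctScale m n with hNdef
  set s : ℝ := k / n - a with hsdef
  set x := 2 * N * s with hx
  have hn' : (0 : ℝ) < n := by positivity
  set u : ℝ := n * (A (k / n) - A a) with hu
  set v : ℝ := -c * x ^ (2 * m) with hv
  have hratio : levelWeight f n k / levelScale f a n = θ * Real.exp u := by
    have hsq : √(2 * Real.pi * n * (a * (1 - a))) ≠ 0 := by positivity
    have hexp : Real.exp u = Real.exp (n * Real.binEntropy (k / n)) * Real.exp (n * f (k / n))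
        / Real.exp (n * (f a + Real.binEntropy a)) := by
      rw [← Real.exp_add, ← Real.exp_sub]
      congr 1
      simp only [hu, hAdef]
      ring
    rw [hexp, levelWeight, levelScale]
    generalize √(2 * Real.pi * n * (a * (1 - a))) = Q at *
    rw [div_div_eq_mul_div, mul_div_assoc', div_left_inj' (Real.exp_pos _).ne']
    linear_combination Real.exp (n * f (k / n)) * hθ2
  have hsx : |s| = |x| / (2 * N) := by
    rw [hx, abs_mul, abs_of_pos (show 0 < 2 * N by positivity)]; field_simp
  have hs2m : (n : ℝ) * |s| ^ (2 * m) ≤ |x| ^ (2 * m) := by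
    rw [hsx, div_pow, mul_pow, hNp]
    have : (1 : ℝ) ≤ 2 ^ (2 * m) := one_le_pow₀ (by norm_num)
    rw [mul_div_assoc', div_le_iff₀ (by positivity)]
    have : 0 ≤ n * |x| ^ (2 * m) := by positivity
    nlinarith
  have huv0 : |u - v| ≤ C₁ * (n * |s| ^ (2 * m)) * |s| := by
    have h := hT s hsc
    have e : a + s = k / n := by rw [hsdef]; ring
    have e2 : u - v = n * (A (a + s) - A a
        - iteratedDeriv (2 * m) A a / (2 * m).factorial * s ^ (2 * m)) := by
      rw [hu, hv, hx, e, hcdef, decayRate, mul_pow, mul_pow, hNp]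
      have : (2 : ℝ) ^ (2 * m) ≠ 0 := by positivity
      field_simp
      ring
    rw [e2, abs_mul, Nat.abs_cast]
    calc _ ≤ (n : ℝ) * (C₁ * |s| ^ (2 * m + 1)) := by gcongr
      _ = _ := by ring
  have hsN : |s| ≤ |x| * (1 / N) := by
    rw [hsx, mul_one_div]
    gcongr
    linarith
  have huv1 : |u - v| ≤ C₁ * |x| ^ (2 * m + 1) * (1 / N) :=
    calc |u - v| ≤ C₁ * (|x| ^ (2 * m)) * (|x| * (1 / N)) := huv0.trans (by gcongr)
      _ = _ := by ring
  have hxe : |x| ^ (2 * m) = x ^ (2 * m) := (even_two_mul m).pow_abs x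
  have hvn : v ≤ v / 2 := by
    have : 0 ≤ c * x ^ (2 * m) := by rw [← hxe]; positivity
    rw [hv]; linarith
  have hun : u ≤ v / 2 := by
    have h2 : |u - v| ≤ -v / 2 := by
      calc |u - v| ≤ C₁ * (|x| ^ (2 * m)) * (c / (2 * C₁)) := huv0.trans (by gcongr)
        _ = -v / 2 := by rw [hv, hxe]; field_simp
    linarith [le_abs_self (u - v)]
  have h1n : (1 : ℝ) / n ≤ 1 / N := by gcongr
  have hv2 : v / 2 = -(c / 2) * x ^ (2 * m) := by rw [hv]; ring
  have hE0 := hE₀ x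
  have hE1 := hE₁ x
  have hE2 := hE₂ x
  rw [← hv2] at hE0 hE1 hE2
  have hN1 : 0 < 1 / N := by positivity
  rw [hratio]
  have e : θ * Real.exp u - Real.exp v = (θ - 1) * Real.exp u + (Real.exp u - Real.exp v) := by
    ring
  calc |θ * Real.exp u - Real.exp v| ≤ |θ - 1| * Real.exp u + |Real.exp u - Real.exp v| := by
        rw [e]
        refine (abs_add_le _ _).trans ?_
        rw [abs_mul, Real.abs_exp]
    _ ≤ C₂ * (1 / N + |x| * (1 / N)) * Real.exp (v / 2)
        + C₁ * |x| ^ (2 * m + 1) * (1 / N) * Real.exp (v / 2) := by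
        refine add_le_add (mul_le_mul (hθ1.trans ?_) (Real.exp_le_exp.2 hun) (Real.exp_pos _).le
          (by positivity)) ((abs_exp_sub_exp_le hun hvn).trans ?_)
        · gcongr
        · gcongr
    _ = 1 / N * (C₂ * (|x| ^ 0 * Real.exp (v / 2)) + C₂ * (|x| ^ 1 * Real.exp (v / 2))
        + C₁ * (|x| ^ (2 * m + 1) * Real.exp (v / 2))) := by ring
    _ ≤ 1 / N * (C₂ * (D₀ * Real.exp (-2 * |x|)) + C₂ * (D₁ * Real.exp (-2 * |x|))
        + C₁ * (D₂ * Real.exp (-2 * |x|))) := by gcongr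
    _ = _ := by ring

open Classical in
/-- The level indices whose fraction of plus spins is within `δ` of `a`. -/
noncomputable def nearLevels (n : ℕ) (a δ : ℝ) : Finset ℕ :=
  (Finset.range (n + 1)).filter fun k => (k / n : ℝ) ∈ Ioo (a - δ) (a + δ)

lemma mem_nearLevels {n k : ℕ} {a δ : ℝ} :
    k ∈ nearLevels n a δ ↔ k ≤ n ∧ |(k / n : ℝ) - a| < δ := by
  rw [nearLevels, Finset.mem_filter, Finset.mem_range, Nat.lt_succ_iff, mem_Ioo, abs_lt]
  constructor <;> rintro ⟨h, h1, h2⟩ <;> exact ⟨h, by linarith, by linarith⟩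

/-- Lattice sums of Lipschitz functions against the level weights near a regular maximizer. -/
lemma exists_nearLevels_sum_approx {f : ℝ → ℝ} {m : ℕ} {a : ℝ} (hm : 1 ≤ m) (h0 : 0 < a)
    (h1 : a < 1) (hA : AnalyticAt ℝ (fun a => f a + Real.binEntropy a) a)
    (hd : ∀ k : ℕ, 1 ≤ k → k ≤ 2 * m - 1 →
      iteratedDeriv k (fun a => f a + Real.binEntropy a) a = 0)
    (hc : 0 < decayRate f m a) :
    ∃ δ₀ : ℝ, 0 < δ₀ ∧ ∀ δ, 0 < δ → δ < δ₀ → ∃ C : ℝ, 0 < C ∧ ∀ᶠ n : ℕ in atTop,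
      ∀ g : ℝ → ℝ, LipschitzWith 1 g → |g 0| ≤ 1 →
        |2 * fluctScale m n / n * (∑ k ∈ nearLevels n a δ,
            g (2 * fluctScale m n * (k / n - a)) * (levelWeight f n k / levelScale f a n))
          - ∫ x, g x * Real.exp (-decayRate f m a * x ^ (2 * m))| ≤ C * (1 / fluctScale m n) := by
  obtain ⟨δ₀, C₀, hδ₀, hδa, hδb, hC₀, hlev⟩ := exists_levelWeight_approx hm h0 h1 hA hd hc
  set c := decayRate f m a with hcdef
  obtain ⟨D₀, hD₀, hE₀⟩ := abs_pow_mul_exp_neg_pow_le hc hm 0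
  obtain ⟨D₁, hD₁, hE₁⟩ := abs_pow_mul_exp_neg_pow_le hc hm 1
  obtain ⟨D₂, hD₂, hE₂⟩ := exp_neg_pow_lipschitz hc hm
  refine ⟨δ₀, hδ₀, fun δ hδ hδ' => ?_⟩
  -- One constant for all hypotheses of the lattice lemma: level weights, size and Lipschitz bound
  -- of the density, and the lattice points outside the window.
  set C : ℝ := C₀ + D₀ + D₂ + D₁ / (2 * δ) with hC
  have hD₁' : 0 < D₁ / (2 * δ) := by positivity
  have hCpos : 0 < C := by positivity
  have hI : 0 ≤ ∫ x : ℝ, Real.exp (-1 * |x|) := integral_nonneg fun _ => (Real.exp_pos _).le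
  refine ⟨(2 * C * Real.exp 1 * ∫ x : ℝ, Real.exp (-1 * |x|)) * 3 + 1, by positivity, ?_⟩
  -- With `N² ≤ n`, `n ≥ 4` gives mesh `η = 2N/n ≤ 1`. The same inequality gives `η ≤ 2/N`, so the
  -- mesh does not spoil the rate.
  filter_upwards [eventually_ge_atTop 4] with n hn4 g hg hg0
  have hn : 0 < n := by omega
  have hn' : (0 : ℝ) < n := by positivity
  have hN := fluctScale_pos (m := m) hn
  have hN1 := one_le_fluctScale (m := m) hn
  have hNsq := fluctScale_sq_le hm hn
  set N := fluctScale m n with hNdef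
  set η := 2 * N / n with hη
  have hη0 : 0 < η := by positivity
  have hη1 : η ≤ 1 := by
    rw [hη, div_le_one hn']
    have hn4' : (4 : ℝ) ≤ n := by exact_mod_cast hn4
    by_contra! h
    nlinarith
  have hηN : η ≤ 2 * (1 / N) := by
    rw [hη, mul_one_div, div_le_div_iff₀ hn' hN]
    nlinarith
  set W : ℤ → ℝ := fun j => if 0 ≤ j ∧ j.toNat ∈ nearLevels n a δ then
    levelWeight f n j.toNat / levelScale f a n else 0 with hW
  have hx : ∀ j : ℤ, η * (j - n * a) = 2 * N * (j / n - a) := fun j => by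
    rw [hη]; field_simp
  have key := lattice_sum_sub_integral_le (C := C) (ε := 1 / N) (η := η) (b := n * a) hCpos
    (by positivity) hη0 hη1 ((nearLevels n a δ).map Nat.castEmbedding) W ?_
    (φ := fun x => Real.exp (-c * x ^ (2 * m))) (g := g) ?_ (by fun_prop) ?_ ?_ hg hg0
  · rw [Finset.sum_map, Finset.mul_sum] at key
    have hsum : ∑ k ∈ nearLevels n a δ, η * (g (η * (((Nat.castEmbedding k : ℤ) : ℝ) - n * a))
        * W (Nat.castEmbedding k)) = η * ∑ k ∈ nearLevels n a δ,
          g (2 * N * (k / n - a)) * (levelWeight f n k / levelScale f a n) := by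
      rw [Finset.mul_sum]
      refine Finset.sum_congr rfl fun k hk => ?_
      rw [hx]
      simp [hW, hk]
    rw [hsum] at key
    refine key.trans ?_
    have : (2 * C * Real.exp 1 * ∫ x : ℝ, Real.exp (-1 * |x|)) * (1 / N + η)
        ≤ (2 * C * Real.exp 1 * ∫ x : ℝ, Real.exp (-1 * |x|)) * (3 * (1 / N)) := by
      gcongr
      linarith
    have : 0 < 1 / N := by positivity
    linarith
  · intro j hj
    simp only [hW]
    rw [if_neg]
    rintro ⟨hj0, hj1⟩
    exact hj (Finset.mem_map.2 ⟨j.toNat, hj1, by simp [hj0]⟩)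
  · intro x
    rw [Real.abs_exp]
    have := hE₀ x
    rw [pow_zero, one_mul] at this
    refine this.trans ?_
    gcongr
    linarith
  · intro x y hxy
    refine (hE₂ x y hxy).trans ?_
    gcongr
    linarith
  · intro j
    rw [hx]
    simp only [hW]
    split_ifs with hj
    · obtain ⟨k, rfl⟩ := Int.eq_ofNat_of_zero_le hj.1
      have hk := mem_nearLevels.1 hj.2
      rw [Int.toNat_natCast] at hk ⊢
      rw [Int.cast_natCast]
      refine (hlev n k hn hk.1 (hk.2.trans hδ')).trans ?_
      gcongr
      linarith
    -- Off the window `W` vanishes, so the density itself must be small. Since `δ < δ₀ ≤ min a (1 -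
    -- a)`, the window lies inside `(0, 1)` and an excluded `j` really is at distance at least `δ`.
    -- There `|x| ≥ 2δN`, and the factor `|x|/(2δN) ≥ 1` supplies the missing `1/N`.
    · have hfar : δ ≤ |(j / n : ℝ) - a| := by
        by_contra! h
        have h2 := abs_lt.1 h
        have hj0 : 0 ≤ j := by
          have : (0 : ℝ) < j / n := by linarith
          have : (0 : ℝ) < j := by
            rcases div_pos_iff.1 this with h | h
            · exact h.1
            · exact absurd h.2 (by linarith)
          exact_mod_cast this.le
        obtain ⟨k, rfl⟩ := Int.eq_ofNat_of_zero_le hj0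
        refine hj ⟨hj0, mem_nearLevels.2 ⟨?_, by simpa using h⟩⟩
        have : ((k : ℤ) / n : ℝ) < 1 := by linarith
        rw [div_lt_one hn', Int.cast_natCast] at this
        rw [Int.toNat_natCast]
        exact_mod_cast this.le
      set x := 2 * N * (j / n - a) with hxdef
      have hxN : 2 * δ ≤ |x| * (1 / N) := by
        rw [hxdef, abs_mul, abs_of_pos (show 0 < 2 * N by positivity)]
        calc 2 * δ ≤ 2 * |(j / n : ℝ) - a| := by gcongr
          _ = 2 * N * |(j / n : ℝ) - a| * (1 / N) := by
            generalize |(j / n : ℝ) - a| = q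
            field_simp
      rw [zero_sub, abs_neg, Real.abs_exp]
      have h3 := hE₁ x
      rw [pow_one] at h3
      calc Real.exp (-c * x ^ (2 * m))
          ≤ (|x| * (1 / N) / (2 * δ)) * Real.exp (-c * x ^ (2 * m)) := by
            refine le_mul_of_one_le_left (Real.exp_pos _).le ?_
            rwa [one_le_div (by positivity)]
        _ = 1 / N / (2 * δ) * (|x| * Real.exp (-c * x ^ (2 * m))) := by ring
        _ ≤ 1 / N / (2 * δ) * (D₁ * Real.exp (-2 * |x|)) := by gcongr
        _ = D₁ / (2 * δ) * (1 / N) * Real.exp (-2 * |x|) := by ring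
        _ ≤ _ := by
            gcongr
            linarith

/-! ### Sums over configurations -/

/-- The number of plus spins. -/
def plusCount {n : ℕ} (ω : Config n) : ℕ := (Finset.univ.filter fun i => ω i = 1).card

lemma plusFraction_eq {n : ℕ} (ω : Config n) : plusFraction ω = (plusCount ω : ℝ) / n := rfl

lemma magnetization_eq {n : ℕ} (ω : Config n) : magnetization ω = 2 * plusCount ω - n := by
  have h : ∀ i, ((ω i : ℤ) : ℝ) = 2 * (if ω i = 1 then 1 else 0) - 1 := fun i => by
    rcases Int.units_eq_one_or (ω i) with h | h <;> norm_num [h]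
  simp only [magnetization, h, Finset.sum_sub_distrib, ← Finset.mul_sum, plusCount,
    Finset.card_filter]
  simp

lemma sum_config_plusCount {n : ℕ} (H : ℕ → ℝ) :
    ∑ ω : Config n, H (plusCount ω) = ∑ k ∈ Finset.range (n + 1), n.choose k * H k := by
  have h := Finset.sum_powerset_apply_card H (x := (Finset.univ : Finset (Fin n)))
  rw [Finset.card_univ, Fintype.card_fin] at h
  simp only [nsmul_eq_mul] at h
  rw [← h]
  refine Finset.sum_nbij' (fun ω => Finset.univ.filter fun i => ω i = 1)
    (fun s i => if i ∈ s then 1 else -1) (by simp) (by simp) ?_ ?_ (by simp [plusCount])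
  · intro ω _
    funext i
    rcases Int.units_eq_one_or (ω i) with h | h <;> simp [h]
  · intro s _
    ext i
    simp

/-- The partition function. -/
noncomputable def partitionSum (f : ℝ → ℝ) (n : ℕ) : ℝ :=
  ∑ k ∈ Finset.range (n + 1), levelWeight f n k

lemma partitionSum_pos (f : ℝ → ℝ) (n : ℕ) : 0 < partitionSum f n := by
  refine Finset.sum_pos (fun k hk => ?_) ⟨0, by simp⟩
  have : 0 < n.choose k := Nat.choose_pos (by simpa [Nat.lt_succ_iff] using hk)
  unfold levelWeight
  positivity

lemma integral_gibbs (f : ℝ → ℝ) (n : ℕ) (H : ℕ → ℝ) :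
    ∫ ω, H (plusCount ω) ∂(gibbs f n)
      = (∑ k ∈ Finset.range (n + 1), H k * levelWeight f n k) / partitionSum f n := by
  have hZ : ∑ ω : Config n, Real.exp (n * f (plusFraction ω)) = partitionSum f n :=
    sum_config_plusCount fun k => Real.exp (n * f (k / n))
  rw [gibbs, integral_tilted, integral_count, integral_count, hZ]
  simp only [smul_eq_mul, plusFraction_eq, Finset.sum_div]
  rw [sum_config_plusCount fun k => Real.exp (n * f (k / n)) / partitionSum f n * H k]
  refine Finset.sum_congr rfl fun k _ => ?_
  rw [levelWeight]
  ring

lemma setIntegral_gibbs (f : ℝ → ℝ) (n : ℕ) (a δ : ℝ) (H : ℕ → ℝ) :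
    ∫ ω in nearEvent n a δ, H (plusCount ω) ∂(gibbs f n)
      = (∑ k ∈ nearLevels n a δ, H k * levelWeight f n k) / partitionSum f n := by
  classical
  rw [← integral_indicator (MeasurableSet.of_discrete)]
  have h := integral_gibbs f n fun k => if (k / n : ℝ) ∈ Ioo (a - δ) (a + δ) then H k else 0
  have e : (fun ω : Config n => (nearEvent n a δ).indicator (fun ω => H (plusCount ω)) ω)
      = fun ω => if (plusCount ω / n : ℝ) ∈ Ioo (a - δ) (a + δ) then H (plusCount ω) else 0 := by
    funext ω
    simp only [indicator_apply, nearEvent, mem_ofPred_eq, plusFraction_eq]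
  rw [e, h, nearLevels, Finset.sum_filter]
  simp only [ite_mul, zero_mul]

lemma integral_cond_gibbs (f : ℝ → ℝ) (n : ℕ) (a δ : ℝ) (H : ℕ → ℝ) :
    ∫ ω, H (plusCount ω) ∂((gibbs f n)[|nearEvent n a δ])
      = (∑ k ∈ nearLevels n a δ, H k * levelWeight f n k)
        / ∑ k ∈ nearLevels n a δ, levelWeight f n k := by
  have h1 := setIntegral_gibbs f n a δ fun _ => 1
  simp only [integral_const, smul_eq_mul, mul_one, one_mul, measureReal_restrict_apply_univ] at h1
  rw [ProbabilityTheory.cond, integral_smul_measure, setIntegral_gibbs, ENNReal.toReal_inv,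
    ← measureReal_def, h1, smul_eq_mul]
  have := (partitionSum_pos f n).ne'
  rw [inv_div, div_mul_div_comm, mul_comm (partitionSum f n), mul_div_mul_right _ _ this]

/-! ### Wasserstein bounds near a regular maximizer -/

lemma abs_div_sub_div_le {t₀ t₁ i₀ i₁ e J : ℝ} (hi : 0 < i₁) (h₀ : |t₀ - i₀| ≤ e)
    (h₁ : |t₁ - i₁| ≤ e) (he : e ≤ i₁ / 2) (hJ : |i₀| ≤ J) :
    |t₀ / t₁ - i₀ / i₁| ≤ (i₁ + J) / (i₁ ^ 2 / 2) * e := by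
  have ht : i₁ / 2 ≤ t₁ := by linarith [(abs_le.1 h₁).1]
  have ht0 : 0 < t₁ := by linarith
  have he0 : 0 ≤ e := (abs_nonneg _).trans h₀
  have e1 : t₀ / t₁ - i₀ / i₁ = ((t₀ - i₀) * i₁ - i₀ * (t₁ - i₁)) / (t₁ * i₁) := by
    field_simp; ring
  rw [e1, abs_div, abs_of_pos (mul_pos ht0 hi), div_mul_eq_mul_div]
  refine div_le_div₀ ?_ ?_ (by positivity) ?_
  · have : 0 ≤ J := (abs_nonneg _).trans hJ
    positivity
  · refine (abs_sub _ _).trans ?_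
    rw [abs_mul, abs_mul, abs_of_pos hi]
    have := mul_le_mul hJ h₁ (abs_nonneg _) ((abs_nonneg _).trans hJ)
    nlinarith
  · nlinarith

lemma integrable_lipschitz_mul_exp_neg_pow {c : ℝ} (hc : 0 < c) {m : ℕ} (hm : 1 ≤ m) {g : ℝ → ℝ}
    (hg : LipschitzWith 1 g) : Integrable fun x => g x * Real.exp (-c * x ^ (2 * m)) := by
  obtain ⟨C, hC, h⟩ := abs_pow_mul_exp_neg_pow_le hc hm 0
  refine integrable_lipschitz_mul (C := C) (fun x => ?_) (by fun_prop) hg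
  rw [Real.abs_exp]
  simpa using h x

lemma integrable_exp_neg_pow {c : ℝ} (hc : 0 < c) {m : ℕ} (hm : 1 ≤ m) :
    Integrable fun x : ℝ => Real.exp (-c * x ^ (2 * m)) := by
  simpa using integrable_lipschitz_mul_exp_neg_pow hc hm (LipschitzWith.const' (1 : ℝ))

lemma integral_exp_neg_pow_pos {c : ℝ} (hc : 0 < c) {m : ℕ} (hm : 1 ≤ m) :
    0 < ∫ x : ℝ, Real.exp (-c * x ^ (2 * m)) :=
  integral_exp_pos (integrable_exp_neg_pow hc hm)

/-- A conditional expectation is the quotient of the lattice sums for `g` and for `1`; the partition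
function and `levelScale` cancel. Replacing `g` by `g - g 0` shifts both expectations equally and
bounds the numerator by the first absolute moment `J`, so the constant is the same for all
1-Lipschitz `g`. -/
lemma exists_wassersteinDist_le {f : ℝ → ℝ} {m : ℕ} {a : ℝ} (hm : 1 ≤ m) (h0 : 0 < a)
    (h1 : a < 1) (hA : AnalyticAt ℝ (fun a => f a + Real.binEntropy a) a)
    (hd : ∀ k : ℕ, 1 ≤ k → k ≤ 2 * m - 1 →
      iteratedDeriv k (fun a => f a + Real.binEntropy a) a = 0)
    (hc : 0 < decayRate f m a) {ν : Measure ℝ}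
    (hν : ∀ g : ℝ → ℝ, LipschitzWith 1 g →
      ∫ x, g x ∂ν = (∫ x, g x * Real.exp (-decayRate f m a * x ^ (2 * m)))
        / ∫ x, Real.exp (-decayRate f m a * x ^ (2 * m))) :
    ∃ δ₀ : ℝ, 0 < δ₀ ∧ ∀ δ, 0 < δ → δ < δ₀ → ∃ C : ℝ, ∀ᶠ n : ℕ in atTop,
      wassersteinDist (((gibbs f n)[|nearEvent n a δ]).map
        fun ω => 2 * fluctScale m n * (plusCount ω / n - a)) ν
          ≤ ENNReal.ofReal (C * (1 / fluctScale m n)) := by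
  obtain ⟨δ₀, hδ₀, h⟩ := exists_nearLevels_sum_approx hm h0 h1 hA hd hc
  refine ⟨δ₀, hδ₀, fun δ hδ hδ' => ?_⟩
  obtain ⟨C, hC, h⟩ := h δ hδ hδ'
  set c := decayRate f m a
  set i₁ := ∫ x : ℝ, Real.exp (-c * x ^ (2 * m)) with hi₁
  have hi : 0 < i₁ := integral_exp_neg_pow_pos hc hm
  have habs : LipschitzWith 1 fun x : ℝ => |x| :=
    LipschitzWith.of_dist_le_mul fun x y => by
      simpa [Real.dist_eq] using abs_abs_sub_abs_le x y
  set J := ∫ x : ℝ, |x| * Real.exp (-c * x ^ (2 * m)) with hJ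
  refine ⟨(i₁ + J) / (i₁ ^ 2 / 2) * C, ?_⟩
  have hlim : Tendsto (fun n => C * (1 / fluctScale m n)) atTop (𝓝 (C * 0)) :=
    (tendsto_const_nhds.div_atTop (tendsto_fluctScale hm)).const_mul C
  rw [mul_zero] at hlim
  filter_upwards [h, hlim.eventually (ge_mem_nhds (half_pos hi)), eventually_gt_atTop 0]
    with n hn hsmall hn0
  refine iSup₂_le fun g hg => ENNReal.ofReal_le_ofReal ?_
  have hn' : (0 : ℝ) < n := by positivity
  have hN := fluctScale_pos (m := m) hn0
  have hK := levelScale_pos f h0 h1 hn0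
  set N := fluctScale m n
  set K := levelScale f a n
  set S := nearLevels n a δ
  have hg' : LipschitzWith 1 fun x => g x - g 0 := by
    simpa using hg.sub (LipschitzWith.const (g 0))
  have hT₁ := hn (fun _ => 1) (LipschitzWith.const' 1) (by simp)
  have hT₀ := hn (fun x => g x - g 0) hg' (by simp)
  simp only [one_mul] at hT₁
  have hb : |∫ x, (g x - g 0) * Real.exp (-c * x ^ (2 * m))| ≤ J := by
    rw [← Real.norm_eq_abs]
    refine norm_integral_le_of_norm_le (integrable_lipschitz_mul_exp_neg_pow hc hm habs)
      (Eventually.of_forall fun x => ?_)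
    rw [norm_mul, Real.norm_eq_abs, Real.norm_eq_abs, Real.abs_exp]
    refine mul_le_mul_of_nonneg_right ?_ (Real.exp_pos _).le
    simpa [Real.dist_eq] using hg.dist_le_mul x 0
  have key := abs_div_sub_div_le hi hT₀ hT₁ hsmall hb
  have ht₁ : 0 < 2 * N / n * ∑ k ∈ S, levelWeight f n k / K := by
    linarith [(abs_le.1 hT₁).1]
  have hsum : 0 < ∑ k ∈ S, levelWeight f n k := by
    rw [← Finset.sum_div] at ht₁
    have h2 : 0 < 2 * N / n := by positivity
    exact (div_pos_iff_of_pos_right hK).1 ((pos_iff_pos_of_mul_pos ht₁).1 h2)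
  rw [integral_map (by fun_prop) hg.continuous.aestronglyMeasurable, hν g hg,
    integral_cond_gibbs f n a δ fun k => g (2 * N * (k / n - a))]
  have e1 : (∑ k ∈ S, g (2 * N * (k / n - a)) * levelWeight f n k) / ∑ k ∈ S, levelWeight f n k
      = (2 * N / n * ∑ k ∈ S, (g (2 * N * (k / n - a)) - g 0) * (levelWeight f n k / K))
        / (2 * N / n * ∑ k ∈ S, levelWeight f n k / K) + g 0 := by
    simp only [← mul_div_assoc]
    rw [← Finset.sum_div, ← Finset.sum_div, mul_div_mul_left _ _ (by positivity),
      div_div_div_cancel_right₀ hK.ne']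
    simp only [sub_mul, Finset.sum_sub_distrib, ← Finset.mul_sum]
    field_simp
    ring
  have e2 : (∫ x, g x * Real.exp (-c * x ^ (2 * m))) / i₁
      = (∫ x, (g x - g 0) * Real.exp (-c * x ^ (2 * m))) / i₁ + g 0 := by
    simp only [sub_mul]
    rw [integral_sub (integrable_lipschitz_mul_exp_neg_pow hc hm hg)
      ((integrable_exp_neg_pow hc hm).const_mul _), integral_const_mul, ← hi₁]
    field_simp
    ring
  rw [e1, e2, add_sub_add_right_eq_sub]
  linarith

/-- The mass of the configurations near a regular maximizer. -/
lemma exists_nearLevels_mass {f : ℝ → ℝ} {m : ℕ} {a : ℝ} (hm : 1 ≤ m) (h0 : 0 < a)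
    (h1 : a < 1) (hA : AnalyticAt ℝ (fun a => f a + Real.binEntropy a) a)
    (hd : ∀ k : ℕ, 1 ≤ k → k ≤ 2 * m - 1 →
      iteratedDeriv k (fun a => f a + Real.binEntropy a) a = 0)
    (hc : 0 < decayRate f m a) :
    ∃ δ₀ c₁ c₂ : ℝ, 0 < δ₀ ∧ 0 < c₁ ∧ 0 < c₂ ∧ ∀ δ, 0 < δ → δ < δ₀ → ∀ᶠ n : ℕ in atTop,
      c₁ * (√n / fluctScale m n * Real.exp (n * (f a + Real.binEntropy a)))
          ≤ ∑ k ∈ nearLevels n a δ, levelWeight f n k ∧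
      ∑ k ∈ nearLevels n a δ, levelWeight f n k
          ≤ c₂ * (√n / fluctScale m n * Real.exp (n * (f a + Real.binEntropy a))) := by
  obtain ⟨δ₀, hδ₀, h⟩ := exists_nearLevels_sum_approx hm h0 h1 hA hd hc
  set c := decayRate f m a
  set i₁ := ∫ x : ℝ, Real.exp (-c * x ^ (2 * m)) with hi₁
  have hi : 0 < i₁ := integral_exp_neg_pow_pos hc hm
  have h1' : 0 < 1 - a := by linarith
  set q := √(2 * Real.pi * (a * (1 - a))) with hq
  have hq0 : 0 < q := by positivity
  -- The normalised sum is within `i₁/2` of `i₁`. Undoing the mesh `2N/n` and the scale `E/(√n q)`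
  -- multiplies it by `√n E/(2qN)`.
  refine ⟨δ₀, i₁ / 2 / (2 * q), 2 * i₁ / (2 * q), hδ₀, by positivity, by positivity,
    fun δ hδ hδ' => ?_⟩
  obtain ⟨C, hC, h⟩ := h δ hδ hδ'
  have hlim : Tendsto (fun n => C * (1 / fluctScale m n)) atTop (𝓝 (C * 0)) :=
    (tendsto_const_nhds.div_atTop (tendsto_fluctScale hm)).const_mul C
  rw [mul_zero] at hlim
  filter_upwards [h, hlim.eventually (ge_mem_nhds (half_pos hi)), eventually_gt_atTop 0]
    with n hn hsmall hn0
  have hn' : (0 : ℝ) < n := by positivity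
  have hN := fluctScale_pos (m := m) hn0
  have hT := hn (fun _ => 1) (LipschitzWith.const' 1) (by simp)
  simp only [one_mul] at hT
  rw [← Finset.sum_div] at hT
  have hT' := abs_le.1 (hT.trans hsmall)
  set N := fluctScale m n
  set E := Real.exp (n * (f a + Real.binEntropy a)) with hE
  have hE0 : 0 < E := Real.exp_pos _
  have hK : levelScale f a n = E / (√n * q) := by
    rw [levelScale, hq, ← Real.sqrt_mul hn'.le]
    congr 2
    ring
  rw [hK] at hT'
  set Z := ∑ k ∈ nearLevels n a δ, levelWeight f n k
  have hsn : 0 < √(n : ℝ) := by positivity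
  have hss : √(n : ℝ) * √n = n := Real.mul_self_sqrt hn'.le
  have e : 2 * N / n * (Z / (E / (√n * q))) = Z / (√n / N * E) * (2 * q) := by
    generalize √(n : ℝ) = w at *
    rw [← hss]
    field_simp
  rw [e] at hT'
  set P := √(n : ℝ) / N * E with hP
  have hP0 : 0 < P := by positivity
  constructor
  · rw [div_mul_eq_mul_div, div_le_iff₀ (by positivity), ← le_div_iff₀ hP0]
    have : Z * (2 * q) / P = Z / P * (2 * q) := by ring
    linarith
  · rw [div_mul_eq_mul_div, le_div_iff₀ (by positivity), ← div_le_iff₀ hP0]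
    have : Z * (2 * q) / P = Z / P * (2 * q) := by ring
    linarith

/-! ### The two coefficients -/

lemma hasDerivAt_spinEntropy {t : ℝ} (h1 : -1 < t) (h2 : t < 1) :
    HasDerivAt spinEntropy ((Real.log (1 - t) - Real.log (1 + t)) / 2) t := by
  have hp : (1 + t) ≠ 0 := by linarith
  have hm : (1 - t) ≠ 0 := by linarith
  have hlp : HasDerivAt (fun t : ℝ => 1 + t) 1 t := by simpa using (hasDerivAt_id t).const_add 1
  have hlm : HasDerivAt (fun t : ℝ => 1 - t) (-1) t := by simpa using (hasDerivAt_id t).const_sub 1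
  have h := ((hlp.div_const 2).neg.mul (hlp.log hp)).sub ((hlm.div_const 2).mul (hlm.log hm))
  refine h.congr_deriv ?_
  rw [Pi.neg_apply]
  field_simp
  ring

lemma log_one_sub_tStar : Real.log (1 - tStar) = Real.log 2 + Real.log (1 / 20) := by
  rw [← Real.log_mul (by norm_num) (by norm_num), tStar]; norm_num

lemma log_one_add_tStar : Real.log (1 + tStar) = Real.log 2 + Real.log (19 / 20) := by
  rw [← Real.log_mul (by norm_num) (by norm_num), tStar]; norm_num

lemma deriv_spinEntropy_tStar :
    deriv spinEntropy tStar = (Real.log (1 / 20) - Real.log (19 / 20)) / 2 := by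
  rw [(hasDerivAt_spinEntropy (by norm_num [tStar]) (by norm_num [tStar])).deriv,
    log_one_sub_tStar, log_one_add_tStar]
  ring

lemma spinEntropy_tStar : spinEntropy tStar =
    -Real.log 2 - 19 / 20 * Real.log (19 / 20) - 1 / 20 * Real.log (1 / 20) := by
  rw [spinEntropy, log_one_sub_tStar, log_one_add_tStar, tStar]
  ring

lemma log_nineteen_div_twenty_near : |Real.log (19 / 20) + 0.05129329| < 0.00000002 := by
  have h := Real.abs_log_sub_add_sum_range_le (x := 1 / 20) (by norm_num [abs_of_pos]) 6
  rw [show (1 : ℝ) - 1 / 20 = 19 / 20 by norm_num, abs_of_pos (by norm_num : (0 : ℝ) < 1 / 20)] at h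
  norm_num [Finset.sum_range_succ] at h
  rw [abs_le] at h
  rw [abs_lt]
  constructor <;> linarith [h.1, h.2]

lemma log_one_div_twenty_eq : Real.log (1 / 20) = -(2 * Real.log 2 + Real.log 5) := by
  rw [one_div, Real.log_inv, show (20 : ℝ) = 2 ^ 2 * 5 by norm_num,
    Real.log_mul (by norm_num) (by norm_num), Real.log_pow]
  norm_num

/-- Once the denominator is cleared, the coefficient enters through an expression affine in `log 2`,
`log 5` and `log (19/20)`, so decimal enclosures of these three suffice. -/
lemma beta_near : |beta - 0.1258| < 0.00005 := by
  have h1 := abs_lt.1 log_nineteen_div_twenty_near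
  have h2 := Real.log_two_gt_d9
  have h3 := Real.log_two_lt_d9
  have h4 := Real.log_five_gt_d9
  have h5 := Real.log_five_lt_d9
  rw [beta, spinEntropy_tStar, deriv_spinEntropy_tStar, log_one_div_twenty_eq, tStar, abs_lt,
    lt_sub_iff_add_lt, sub_lt_iff_lt_add, lt_div_iff₀ (by norm_num), div_lt_iff₀ (by norm_num)]
  norm_num at h1 h2 h3 h4 h5 ⊢
  constructor <;> linarith [h1.1, h1.2]

lemma field_near : |field - 0.0386| < 0.00005 := by
  have h1 := abs_lt.1 log_nineteen_div_twenty_near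
  have h2 := Real.log_two_gt_d9
  have h3 := Real.log_two_lt_d9
  have h4 := Real.log_five_gt_d9
  have h5 := Real.log_five_lt_d9
  rw [field, spinEntropy_tStar, deriv_spinEntropy_tStar, log_one_div_twenty_eq, tStar, abs_lt,
    lt_sub_iff_add_lt, sub_lt_iff_lt_add, lt_div_iff₀ (by norm_num), div_lt_iff₀ (by norm_num)]
  norm_num at h1 h2 h3 h4 h5 ⊢
  constructor <;> linarith [h1.1, h1.2]

/-! ### Derivatives of the free energy -/

/-- The derivatives of the free energy on `(0, 1)`, up to order four. -/
noncomputable def freeEnergyDeriv : ℕ → ℝ → ℝ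
  | 0, a => freeEnergy a
  | 1, a => 12 * beta * (2 * a - 1) ^ 5 + 10 * field * (2 * a - 1) ^ 4 + 2 * (2 * a - 1)
      + (Real.log (1 - a) - Real.log a)
  | 2, a => 120 * beta * (2 * a - 1) ^ 4 + 80 * field * (2 * a - 1) ^ 3 + 4
      + (-(1 - a)⁻¹ - a⁻¹)
  | 3, a => 960 * beta * (2 * a - 1) ^ 3 + 480 * field * (2 * a - 1) ^ 2
      + (-((1 - a) ^ 2)⁻¹ + (a ^ 2)⁻¹)
  | 4, a => 5760 * beta * (2 * a - 1) ^ 2 + 1920 * field * (2 * a - 1)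
      + (-2 * ((1 - a) ^ 3)⁻¹ - 2 * (a ^ 3)⁻¹)
  | _, _ => 0

lemma hasDerivAt_freeEnergyDeriv {k : ℕ} (hk : k < 4) {a : ℝ} (ha : a ∈ Ioo (0 : ℝ) 1) :
    HasDerivAt (freeEnergyDeriv k) (freeEnergyDeriv (k + 1) a) a := by
  have h0 : a ≠ 0 := ha.1.ne'
  have h1 : 1 - a ≠ 0 := by linarith [ha.2]
  have ht : HasDerivAt (fun a : ℝ => 2 * a - 1) 2 a := by
    simpa using ((hasDerivAt_id a).const_mul 2).sub_const 1
  have hs : HasDerivAt (fun a : ℝ => 1 - a) (-1) a := by simpa using (hasDerivAt_id a).const_sub 1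
  have hi := hasDerivAt_id a
  interval_cases k
  · have h := ((((ht.pow 6).const_mul beta).add ((ht.pow 5).const_mul field)).add
      ((ht.pow 2).div_const 2)).add (Real.hasDerivAt_binEntropy h0 (by linarith [ha.2] : a < 1).ne)
    refine h.congr_deriv ?_
    simp only [freeEnergyDeriv]
    push_cast
    ring
  · have h := ((((ht.pow 5).const_mul (12 * beta)).add ((ht.pow 4).const_mul (10 * field))).add
      (ht.const_mul 2)).add ((hs.log h1).sub (Real.hasDerivAt_log h0))
    refine h.congr_deriv ?_
    simp only [freeEnergyDeriv]
    push_cast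
    ring
  · have h := ((((ht.pow 4).const_mul (120 * beta)).add ((ht.pow 3).const_mul (80 * field))).add_const
      4).add ((hs.inv h1).neg.sub (hi.inv h0))
    refine h.congr_deriv ?_
    simp only [freeEnergyDeriv, id]
    push_cast
    field_simp
    ring
  · have h := (((ht.pow 3).const_mul (960 * beta)).add ((ht.pow 2).const_mul (480 * field))).add
      (((hs.pow 2).inv (pow_ne_zero 2 h1)).neg.add ((hi.pow 2).inv (pow_ne_zero 2 h0)))
    refine h.congr_deriv ?_
    simp only [freeEnergyDeriv, id, Pi.pow_apply]
    push_cast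
    field_simp
    ring

lemma iteratedDeriv_freeEnergy {k : ℕ} (hk : k ≤ 4) {a : ℝ} (ha : a ∈ Ioo (0 : ℝ) 1) :
    iteratedDeriv k freeEnergy a = freeEnergyDeriv k a := by
  induction k generalizing a with
  | zero => rw [iteratedDeriv_zero]; rfl
  | succ k ih =>
    rw [iteratedDeriv_succ, ← (hasDerivAt_freeEnergyDeriv hk ha).deriv]
    refine Filter.EventuallyEq.deriv_eq ?_
    filter_upwards [isOpen_Ioo.mem_nhds ha] with b hb using ih (by omega) hb

lemma analyticAt_freeEnergy {a : ℝ} (ha : a ∈ Ioo (0 : ℝ) 1) : AnalyticAt ℝ freeEnergy a := by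
  have h0 : a ≠ 0 := ha.1.ne'
  have h1 : 1 - a ≠ 0 := by linarith [ha.2]
  have hi : AnalyticAt ℝ (fun a : ℝ => a) a := analyticAt_id
  have hs : AnalyticAt ℝ (fun a : ℝ => 1 - a) a := analyticAt_const.sub analyticAt_id
  have hb : AnalyticAt ℝ Real.binEntropy a :=
    (hi.mul ((hi.inv h0).log (inv_pos.2 ha.1))).add
      (hs.mul ((hs.inv h1).log (inv_pos.2 (by linarith [ha.2]))))
  have he : AnalyticAt ℝ energy a := by
    unfold energy
    fun_prop
  exact he.add hb

lemma continuous_freeEnergy : Continuous freeEnergy := by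
  unfold freeEnergy energy
  fun_prop

/-! ### The shape of the free energy -/

lemma freeEnergy_half : freeEnergy (1 / 2) = Real.log 2 := by
  rw [freeEnergy, energy, one_div, Real.binEntropy_two_inv]
  norm_num

/-- In the variable `t = 2a - 1` the entropy is `log 2 + E(t)`. The definitions of `beta` and
`field` add up to `β t⁶ + h t⁵ = -t²/2 - E(t)` at `t_*`, which is this equality. Their combination
with weights 6 and 5 is the vanishing of `A'`. -/
lemma freeEnergy_nineteen_div_twenty : freeEnergy (19 / 20) = Real.log 2 := by
  have hb : beta * tStar ^ 6
      = 3 * tStar ^ 2 / 2 + 5 * spinEntropy tStar - tStar * deriv spinEntropy tStar :=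
    div_mul_cancel₀ _ (by norm_num [tStar])
  have hf : field * tStar ^ 5
      = -2 * tStar ^ 2 - 6 * spinEntropy tStar + tStar * deriv spinEntropy tStar :=
    div_mul_cancel₀ _ (by norm_num [tStar])
  rw [spinEntropy_tStar, deriv_spinEntropy_tStar] at hb hf
  rw [freeEnergy, energy, Real.binEntropy, Real.log_inv, Real.log_inv,
    show (2 * (19 / 20) - 1 : ℝ) = tStar by norm_num [tStar], hb, hf,
    show (1 - 19 / 20 : ℝ) = 1 / 20 by norm_num, tStar]
  ring

lemma freeEnergyDeriv_one_half : freeEnergyDeriv 1 (1 / 2) = 0 := by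
  norm_num [freeEnergyDeriv]

lemma freeEnergyDeriv_one_nineteen_div_twenty : freeEnergyDeriv 1 (19 / 20) = 0 := by
  have hb : beta * tStar ^ 6
      = 3 * tStar ^ 2 / 2 + 5 * spinEntropy tStar - tStar * deriv spinEntropy tStar :=
    div_mul_cancel₀ _ (by norm_num [tStar])
  have hf : field * tStar ^ 5
      = -2 * tStar ^ 2 - 6 * spinEntropy tStar + tStar * deriv spinEntropy tStar :=
    div_mul_cancel₀ _ (by norm_num [tStar])
  rw [spinEntropy_tStar, deriv_spinEntropy_tStar] at hb hf
  simp only [freeEnergyDeriv]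
  rw [show (1 - 19 / 20 : ℝ) = 1 / 20 by norm_num]
  rw [tStar] at hb hf
  -- The coefficients are `12/t_*` and `10/t_*`, from `12β t⁵` and `10h t⁴`.
  linear_combination (40 / 3) * hb + (100 / 9) * hf

/-- The polynomial that carries the sign of the second derivative of the free energy at
`(1 + t) / 2`. -/
noncomputable def curvaturePoly (t : ℝ) : ℝ :=
  (1 - t ^ 2) * (30 * beta * t ^ 2 + 20 * field * t) - 1

/-- Since `4a(1 - a) = 1 - t²`, the quadratic energy and the entropy contribute `4 - 1/(a(1 - a)) =
-t²/(a(1 - a))`: the pair coupling is exactly critical, and `t²` factors out. -/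
lemma freeEnergyDeriv_two_eq {a : ℝ} (ha : a ∈ Ioo (0 : ℝ) 1) :
    freeEnergyDeriv 2 a = (2 * a - 1) ^ 2 / (a * (1 - a)) * curvaturePoly (2 * a - 1) := by
  have h0 : a ≠ 0 := ha.1.ne'
  have h1 : 1 - a ≠ 0 := by linarith [ha.2]
  simp only [freeEnergyDeriv, curvaturePoly]
  field_simp
  ring

/-- As `h > 0`, the odd term only helps. The rest is at most `30β/4 - 1`, because `(1 - t²)t² ≤
1/4`, and `β < 2/15`. -/
lemma curvaturePoly_neg_of_nonpos {t : ℝ} (h1 : -1 < t) (h2 : t ≤ 0) : curvaturePoly t < 0 := by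
  have hb := (abs_lt.1 beta_near).2
  have hb' := (abs_lt.1 beta_near).1
  have hf := (abs_lt.1 field_near).1
  norm_num at hb hb' hf
  have h3 : 0 ≤ 1 - t ^ 2 := by nlinarith
  have h4 : (1 - t ^ 2) * t ^ 2 ≤ 1 / 4 := by nlinarith [sq_nonneg (t ^ 2 - 1 / 2)]
  have h5 : 0 ≤ (1 - t ^ 2) * t ^ 2 := by positivity
  have h6 : field * ((1 - t ^ 2) * t) ≤ 0 :=
    mul_nonpos_of_nonneg_of_nonpos (by linarith) (mul_nonpos_of_nonneg_of_nonpos h3 h2)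
  have h7 : beta * ((1 - t ^ 2) * t ^ 2) ≤ beta * (1 / 4) :=
    mul_le_mul_of_nonneg_left h4 (by linarith)
  unfold curvaturePoly
  nlinarith

/-- Signs at `2/5`, `3/5`, `22/25` produce two zeros. The quadratic cofactor has positive
coefficients, so there is no third zero in `t ≥ 0` and the sign pattern of `A''` is known. -/
lemma exists_curvaturePoly_factorization : ∃ t₁ t₂ : ℝ, 0 < t₁ ∧ t₁ < t₂ ∧ t₂ < 9 / 10 ∧
    ∀ t, 0 ≤ t → ∃ r, 0 < r ∧ curvaturePoly t = -(t - t₁) * (t - t₂) * r := by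
  have hb := abs_lt.1 beta_near
  have hf := abs_lt.1 field_near
  norm_num at hb hf
  have hcont : Continuous curvaturePoly := by unfold curvaturePoly; fun_prop
  have v1 : curvaturePoly (2 / 5) < 0 := by unfold curvaturePoly; norm_num; linarith [hb.1, hb.2]
  have v2 : 0 < curvaturePoly (3 / 5) := by unfold curvaturePoly; norm_num; linarith [hb.1, hb.2]
  have v3 : curvaturePoly (22 / 25) < 0 := by
    unfold curvaturePoly; norm_num; linarith [hb.1, hb.2]
  obtain ⟨t₁, ht₁, hz₁⟩ := intermediate_value_Ioo (by norm_num) hcont.continuousOn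
    (show (0 : ℝ) ∈ Ioo (curvaturePoly (2 / 5)) (curvaturePoly (3 / 5)) from ⟨v1, v2⟩)
  obtain ⟨t₂, ht₂, hz₂⟩ := intermediate_value_Ioo' (by norm_num) hcont.continuousOn
    (show (0 : ℝ) ∈ Ioo (curvaturePoly (22 / 25)) (curvaturePoly (3 / 5)) from ⟨v3, v2⟩)
  have h1 : 0 < t₁ := by linarith [ht₁.1]
  have h2 : 0 < t₂ := by linarith [ht₂.1]
  have h12 : t₁ < t₂ := ht₁.2.trans ht₂.1
  have hβ : 0 < beta := by linarith [hb.1]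
  have hh : 0 < field := by linarith [hf.1]
  refine ⟨t₁, t₂, h1, h12, by linarith [ht₂.2], fun t ht => ?_⟩
  -- `B`, `K`, `D` match the coefficients of degree 4, 3 and 0. The remaining discrepancy `α s² + γ
  -- s` vanishes at the nonzero distinct points `t₁`, `t₂`, hence identically.
  set B := 30 * beta with hB
  set K := 20 * field + B * (t₁ + t₂) with hK
  set D := 1 / (t₁ * t₂) with hD
  have hDe : D * (t₁ * t₂) = 1 := by rw [hD]; field_simp
  refine ⟨B * t ^ 2 + K * t + D, by positivity, ?_⟩
  set α := B + (D - K * (t₁ + t₂) + B * (t₁ * t₂)) with hα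
  set γ := 20 * field + (K * (t₁ * t₂) - D * (t₁ + t₂)) with hγ
  have key : ∀ s, curvaturePoly s + (s - t₁) * (s - t₂) * (B * s ^ 2 + K * s + D)
      = α * s ^ 2 + γ * s := fun s => by
    unfold curvaturePoly
    linear_combination hDe
  have e1 : α * t₁ + γ = 0 := by
    have := key t₁
    rw [hz₁] at this
    have : t₁ * (α * t₁ + γ) = 0 := by linear_combination -this
    exact (mul_eq_zero.1 this).resolve_left h1.ne'
  have e2 : α * t₂ + γ = 0 := by
    have := key t₂
    rw [hz₂] at this
    have : t₂ * (α * t₂ + γ) = 0 := by linear_combination -this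
    exact (mul_eq_zero.1 this).resolve_left h2.ne'
  have e3 : α = 0 := by
    have : α * (t₁ - t₂) = 0 := by linear_combination e1 - e2
    exact (mul_eq_zero.1 this).resolve_right (by linarith)
  have e4 : γ = 0 := by rw [e3] at e1; linarith
  have := key t
  rw [e3, e4] at this
  linear_combination this

lemma deriv_freeEnergyDeriv {k : ℕ} (hk : k < 4) {a : ℝ} (ha : a ∈ Ioo (0 : ℝ) 1) :
    deriv (freeEnergyDeriv k) a = freeEnergyDeriv (k + 1) a :=
  (hasDerivAt_freeEnergyDeriv hk ha).deriv

lemma strictAntiOn_freeEnergyDeriv_one {s : Set ℝ} (hs : Convex ℝ s) (hs' : s ⊆ Ioo 0 1)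
    (h : ∀ a ∈ interior s, freeEnergyDeriv 2 a < 0) : StrictAntiOn (freeEnergyDeriv 1) s := by
  refine strictAntiOn_of_deriv_neg hs (fun a ha => ?_) fun a ha => ?_
  · exact (hasDerivAt_freeEnergyDeriv (by norm_num) (hs' ha)).continuousAt.continuousWithinAt
  · rw [deriv_freeEnergyDeriv (by norm_num) (hs' (interior_subset ha))]
    exact h a ha

lemma strictMonoOn_freeEnergy {b c : ℝ} (hb : 0 ≤ b) (hc : c ≤ 1)
    (h : ∀ a ∈ Ioo b c, 0 < freeEnergyDeriv 1 a) : StrictMonoOn freeEnergy (Icc b c) := by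
  refine strictMonoOn_of_deriv_pos (convex_Icc b c) continuous_freeEnergy.continuousOn fun a ha => ?_
  rw [interior_Icc] at ha
  have := deriv_freeEnergyDeriv (k := 0) (by norm_num)
    (show a ∈ Ioo (0 : ℝ) 1 from ⟨hb.trans_lt ha.1, ha.2.trans_le hc⟩)
  exact (h a ha).trans_eq this.symm

lemma strictAntiOn_freeEnergy {b c : ℝ} (hb : 0 ≤ b) (hc : c ≤ 1)
    (h : ∀ a ∈ Ioo b c, freeEnergyDeriv 1 a < 0) : StrictAntiOn freeEnergy (Icc b c) := by
  refine strictAntiOn_of_deriv_neg (convex_Icc b c) continuous_freeEnergy.continuousOn fun a ha => ?_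
  rw [interior_Icc] at ha
  have := deriv_freeEnergyDeriv (k := 0) (by norm_num)
    (show a ∈ Ioo (0 : ℝ) 1 from ⟨hb.trans_lt ha.1, ha.2.trans_le hc⟩)
  exact this.trans_lt (h a ha)

lemma freeEnergyDeriv_two_neg {a : ℝ} (ha : a ∈ Ioo (0 : ℝ) 1) (h : a ≠ 1 / 2)
    (hc : curvaturePoly (2 * a - 1) < 0) : freeEnergyDeriv 2 a < 0 := by
  rw [freeEnergyDeriv_two_eq ha]
  have h0 := ha.1
  have h1 : 0 < 1 - a := by linarith [ha.2]
  have h2 : 2 * a - 1 ≠ 0 := fun h' => h (by linarith)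
  exact mul_neg_of_pos_of_neg (by positivity) hc

/-- `A'` strictly decreases on `(0, 1/2]`, `[1/2, a₁]` and `[a₂, 1)`, and vanishes at `1/2` and
`19/20`. So each of these is the strict maximum over its concave stretch, with value `log 2`.
Working with `A'` tolerates the isolated zero of `A''` at `1/2`. -/
lemma freeEnergy_lt {a : ℝ} (ha : a ∈ Icc (0 : ℝ) 1) (h1 : a ≠ 1 / 2) (h2 : a ≠ 19 / 20) :
    freeEnergy a < Real.log 2 := by
  obtain ⟨t₁, t₂, ht₁, ht₁₂, ht₂, hfac⟩ := exists_curvaturePoly_factorization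
  set a₁ := (1 + t₁) / 2 with ha₁
  set a₂ := (1 + t₂) / 2 with ha₂
  have hmid : ∀ b, 1 / 2 < b → b ≤ a₁ → freeEnergy b < Real.log 2 := by
    have hA : StrictAntiOn (freeEnergyDeriv 1) (Icc (1 / 2) a₁) := by
      refine strictAntiOn_freeEnergyDeriv_one (convex_Icc _ _)
        (fun b hb => ⟨by linarith [hb.1], by linarith [hb.2]⟩) fun b hb => ?_
      rw [interior_Icc] at hb
      obtain ⟨r, hr, hre⟩ := hfac (2 * b - 1) (by linarith [hb.1])
      refine freeEnergyDeriv_two_neg ⟨by linarith [hb.1], by linarith [hb.2]⟩ hb.1.ne' ?_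
      rw [hre]
      have h3 : 0 < t₁ - (2 * b - 1) := by linarith [hb.2]
      have h4 : 0 < t₂ - (2 * b - 1) := by linarith
      nlinarith [mul_pos (mul_pos h3 h4) hr]
    have hB := strictAntiOn_freeEnergy (b := 1 / 2) (c := a₁) (by norm_num) (by linarith)
      fun b hb => by
        rw [← freeEnergyDeriv_one_half]
        exact hA (left_mem_Icc.2 (by linarith)) (Ioo_subset_Icc_self hb) hb.1
    intro b hb hb'
    rw [← freeEnergy_half]
    exact hB (left_mem_Icc.2 (by linarith)) ⟨hb.le, hb'⟩ hb
  have hright : ∀ b, a₂ ≤ b → b ≤ 1 → b ≠ 19 / 20 → freeEnergy b < Real.log 2 := by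
    have hA : StrictAntiOn (freeEnergyDeriv 1) (Ico a₂ 1) := by
      refine strictAntiOn_freeEnergyDeriv_one (convex_Ico _ _)
        (fun b hb => ⟨by linarith [hb.1], by linarith [hb.2]⟩) fun b hb => ?_
      rw [interior_Ico] at hb
      obtain ⟨r, hr, hre⟩ := hfac (2 * b - 1) (by linarith [hb.1])
      refine freeEnergyDeriv_two_neg ⟨by linarith [hb.1], by linarith [hb.2]⟩
        (by linarith [hb.1] : 1 / 2 < b).ne' ?_
      rw [hre]
      have h3 : 0 < (2 * b - 1) - t₁ := by linarith [hb.1]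
      have h4 : 0 < (2 * b - 1) - t₂ := by linarith [hb.1]
      nlinarith [mul_pos (mul_pos h3 h4) hr]
    have hmem : (19 / 20 : ℝ) ∈ Ico a₂ 1 := ⟨by linarith, by norm_num⟩
    have hB := strictMonoOn_freeEnergy (b := a₂) (c := 19 / 20) (by linarith) (by norm_num)
      fun b hb => by
        rw [← freeEnergyDeriv_one_nineteen_div_twenty]
        exact hA ⟨hb.1.le, by linarith [hb.2]⟩ hmem hb.2
    have hC := strictAntiOn_freeEnergy (b := 19 / 20) (c := 1) (by norm_num) le_rfl
      fun b hb => by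
        rw [← freeEnergyDeriv_one_nineteen_div_twenty]
        exact hA hmem ⟨by linarith [hb.1, hmem.1], hb.2⟩ hb.1
    intro b hb hb' hne
    rw [← freeEnergy_nineteen_div_twenty]
    rcases lt_or_gt_of_ne hne with h | h
    · exact hB ⟨hb, h.le⟩ (right_mem_Icc.2 hmem.1) h
    · exact hC (left_mem_Icc.2 (by norm_num)) ⟨h.le, hb'⟩ h
  rcases lt_or_gt_of_ne h1 with h | h
  · have hA : StrictAntiOn (freeEnergyDeriv 1) (Ioc 0 (1 / 2)) := by
      refine strictAntiOn_freeEnergyDeriv_one (convex_Ioc _ _)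
        (fun b hb => ⟨hb.1, by linarith [hb.2]⟩) fun b hb => ?_
      rw [interior_Ioc] at hb
      exact freeEnergyDeriv_two_neg ⟨hb.1, by linarith [hb.2]⟩ hb.2.ne
        (curvaturePoly_neg_of_nonpos (by linarith [hb.1]) (by linarith [hb.2]))
    have hB := strictMonoOn_freeEnergy (b := 0) (c := 1 / 2) le_rfl (by norm_num) fun b hb => by
      rw [← freeEnergyDeriv_one_half]
      exact hA ⟨hb.1, hb.2.le⟩ (right_mem_Ioc.2 (by norm_num)) hb.2
    rw [← freeEnergy_half]
    exact hB ⟨ha.1, h.le⟩ (right_mem_Icc.2 (by norm_num)) h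
  rcases le_total a a₁ with h3 | h3
  · exact hmid a h h3
  rcases le_total a₂ a with h4 | h4
  · exact hright a h4 ha.2 h2
  have hsub : ∀ b ∈ Icc a₁ a₂, b ∈ Ioo (0 : ℝ) 1 := fun b hb =>
    ⟨by linarith [hb.1], by linarith [hb.2]⟩
  -- On the convex stretch `A` is at most its larger end value, and both ends are already known to
  -- lie below `log 2`.
  have hconv : ConvexOn ℝ (Icc a₁ a₂) freeEnergy := by
    refine convexOn_of_hasDerivWithinAt2_nonneg (convex_Icc _ _) continuous_freeEnergy.continuousOn
      (f' := freeEnergyDeriv 1) (f'' := freeEnergyDeriv 2) ?_ ?_ ?_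
    · intro b hb
      exact (hasDerivAt_freeEnergyDeriv (k := 0) (by norm_num)
        (hsub b (interior_subset hb))).hasDerivWithinAt
    · intro b hb
      exact (hasDerivAt_freeEnergyDeriv (k := 1) (by norm_num)
        (hsub b (interior_subset hb))).hasDerivWithinAt
    · intro b hb
      have hb' := interior_subset hb
      have hb'' := hsub b hb'
      obtain ⟨r, hr, hre⟩ := hfac (2 * b - 1) (by linarith [hb'.1])
      rw [freeEnergyDeriv_two_eq hb'', hre]
      have h5 : 0 ≤ (2 * b - 1) - t₁ := by linarith [hb'.1]
      have h6 : 0 ≤ t₂ - (2 * b - 1) := by linarith [hb'.2]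
      have h7 := hb''.1
      have h8 : 0 < 1 - b := by linarith [hb''.2]
      refine mul_nonneg (by positivity) ?_
      have := mul_nonneg (mul_nonneg h5 h6) hr.le
      linarith
  refine (hconv.le_max_of_mem_Icc (left_mem_Icc.2 (h3.trans h4)) (right_mem_Icc.2 (h3.trans h4))
    ⟨h3, h4⟩).trans_lt (max_lt (hmid a₁ (by linarith) le_rfl)
      (hright a₂ le_rfl (by linarith) (by linarith : a₂ < 19 / 20).ne))

lemma freeEnergy_le {a : ℝ} (ha : a ∈ Icc (0 : ℝ) 1) : freeEnergy a ≤ Real.log 2 := by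
  by_cases h1 : a = 1 / 2
  · rw [h1, freeEnergy_half]
  by_cases h2 : a = 19 / 20
  · rw [h2, freeEnergy_nineteen_div_twenty]
  exact (freeEnergy_lt ha h1 h2).le

lemma setOf_isMaxOn_freeEnergy :
    {a : ℝ | a ∈ Icc (0 : ℝ) 1 ∧ IsMaxOn freeEnergy (Icc 0 1) a} = {1 / 2, 19 / 20} := by
  ext a
  constructor
  · rintro ⟨ha, hmax⟩
    by_contra h
    rw [mem_insert_iff, mem_singleton_iff, not_or] at h
    have h1 := freeEnergy_lt ha h.1 h.2
    have h2 : freeEnergy (1 / 2) ≤ freeEnergy a :=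
      hmax (show (1 / 2 : ℝ) ∈ Icc 0 1 by constructor <;> norm_num)
    rw [freeEnergy_half] at h2
    linarith
  · rintro (rfl | rfl)
    · refine ⟨by constructor <;> norm_num, fun b hb => ?_⟩
      rw [mem_ofPred_eq, freeEnergy_half]
      exact freeEnergy_le hb
    · refine ⟨by constructor <;> norm_num, fun b hb => ?_⟩
      rw [mem_ofPred_eq, freeEnergy_nineteen_div_twenty]
      exact freeEnergy_le hb

lemma iteratedDeriv_freeEnergy_half {k : ℕ} (h1 : 1 ≤ k) (h2 : k ≤ 3) :
    iteratedDeriv k freeEnergy (1 / 2) = 0 := by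
  rw [iteratedDeriv_freeEnergy (by omega) (by constructor <;> norm_num)]
  interval_cases k <;> norm_num [freeEnergyDeriv]

lemma iteratedDeriv_four_freeEnergy_half : iteratedDeriv 4 freeEnergy (1 / 2) = -32 := by
  rw [iteratedDeriv_freeEnergy le_rfl (by constructor <;> norm_num)]
  norm_num [freeEnergyDeriv]

lemma iteratedDeriv_one_freeEnergy_nineteen_div_twenty :
    iteratedDeriv 1 freeEnergy (19 / 20) = 0 := by
  rw [iteratedDeriv_freeEnergy (by norm_num) (by constructor <;> norm_num)]
  exact freeEnergyDeriv_one_nineteen_div_twenty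

lemma iteratedDeriv_two_freeEnergy_nineteen_div_twenty :
    iteratedDeriv 2 freeEnergy (19 / 20) < 0 := by
  have hm : (19 / 20 : ℝ) ∈ Ioo (0 : ℝ) 1 := by constructor <;> norm_num
  rw [iteratedDeriv_freeEnergy (by norm_num) hm]
  refine freeEnergyDeriv_two_neg hm (by norm_num) ?_
  have hb := abs_lt.1 beta_near
  have hf := abs_lt.1 field_near
  unfold curvaturePoly
  norm_num at hb hf ⊢
  linarith [hb.2, hf.2]

lemma isRegularMaximizer_half : IsRegularMaximizer freeEnergy 2 (1 / 2) := by
  have hm : (1 / 2 : ℝ) ∈ Ioo (0 : ℝ) 1 := by constructor <;> norm_num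
  have hmem : (1 / 2 : ℝ) ∈ {a : ℝ | a ∈ Icc (0 : ℝ) 1 ∧ IsMaxOn freeEnergy (Icc 0 1) a} := by
    rw [setOf_isMaxOn_freeEnergy]; simp
  refine ⟨by norm_num, hm, hmem.2, (analyticAt_freeEnergy hm).contDiffAt,
    fun k h1 h2 => iteratedDeriv_freeEnergy_half h1 h2, ?_⟩
  norm_num [iteratedDeriv_four_freeEnergy_half]

lemma isRegularMaximizer_nineteen_div_twenty : IsRegularMaximizer freeEnergy 1 (19 / 20) := by
  have hm : (19 / 20 : ℝ) ∈ Ioo (0 : ℝ) 1 := by constructor <;> norm_num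
  have hmem : (19 / 20 : ℝ) ∈ {a : ℝ | a ∈ Icc (0 : ℝ) 1 ∧ IsMaxOn freeEnergy (Icc 0 1) a} := by
    rw [setOf_isMaxOn_freeEnergy]; simp
  refine ⟨le_rfl, hm, hmem.2, (analyticAt_freeEnergy hm).contDiffAt, fun k h1 h2 => ?_,
    iteratedDeriv_two_freeEnergy_nineteen_div_twenty⟩
  obtain rfl : k = 1 := by omega
  exact iteratedDeriv_one_freeEnergy_nineteen_div_twenty

/-! ### Concentration of the magnetization -/

lemma decayRate_energy (m : ℕ) (a : ℝ) : decayRate energy m a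
    = -(iteratedDeriv (2 * m) freeEnergy a / (2 ^ (2 * m) * (2 * m).factorial)) := rfl

lemma decayRate_pos_of_isRegularMaximizer {m : ℕ} {a : ℝ}
    (h : IsRegularMaximizer freeEnergy m a) : 0 < decayRate energy m a := by
  rw [decayRate_energy, neg_pos]
  exact div_neg_of_neg_of_pos h.2.2.2.2.2 (by positivity)

lemma levelWeight_le {f : ℝ → ℝ} {n k : ℕ} (hn : 0 < n) (hk : k ≤ n) :
    levelWeight f n k ≤ Real.exp (n * (f (k / n) + Real.binEntropy (k / n))) := by
  rw [mul_add, add_comm, Real.exp_add, levelWeight]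
  gcongr
  exact choose_le_exp_binEntropy hn hk

/-- Compactness turns the strict inequality away from the maximizers into a uniform gap. For large
`δ` the compact set is empty and any `κ` serves. -/
lemma exists_freeEnergy_gap {δ : ℝ} (hδ : 0 < δ) : ∃ κ : ℝ, 0 < κ ∧ ∀ a ∈ Icc (0 : ℝ) 1,
    δ ≤ |a - 1 / 2| → δ ≤ |a - 19 / 20| → freeEnergy a ≤ Real.log 2 - κ := by
  set s : Set ℝ := Icc 0 1 ∩ ({a | δ ≤ |a - 1 / 2|} ∩ {a | δ ≤ |a - 19 / 20|}) with hs
  have hcomp : IsCompact s := isCompact_Icc.inter_right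
    ((isClosed_le continuous_const (by fun_prop)).inter
      (isClosed_le continuous_const (by fun_prop)))
  rcases s.eq_empty_or_nonempty with he | hne
  · refine ⟨1, one_pos, fun a ha h1 h2 => ?_⟩
    have : a ∈ s := ⟨ha, h1, h2⟩
    rw [he] at this
    exact this.elim
  · obtain ⟨b, hb, hmax⟩ := hcomp.exists_isMaxOn hne continuous_freeEnergy.continuousOn
    have hlt : freeEnergy b < Real.log 2 := by
      refine freeEnergy_lt hb.1 ?_ ?_
      · rintro rfl
        have : δ ≤ |(1 / 2 : ℝ) - 1 / 2| := hb.2.1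
        rw [sub_self, abs_zero] at this
        linarith
      · rintro rfl
        have : δ ≤ |(19 / 20 : ℝ) - 19 / 20| := hb.2.2
        rw [sub_self, abs_zero] at this
        linarith
    refine ⟨Real.log 2 - freeEnergy b, by linarith, fun a ha h1 h2 => ?_⟩
    have : freeEnergy a ≤ freeEnergy b := hmax (show a ∈ s from ⟨ha, h1, h2⟩)
    linarith

/-- The total weight of the levels far from `1 / 2`. -/
noncomputable def farSum (n : ℕ) (δ : ℝ) : ℝ :=
  ∑ k ∈ Finset.range (n + 1) \ nearLevels n (1 / 2) δ, levelWeight energy n k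

lemma farSum_nonneg (n : ℕ) (δ : ℝ) : 0 ≤ farSum n δ :=
  Finset.sum_nonneg fun _ _ => levelWeight_nonneg _ _ _

lemma nearLevels_subset (n : ℕ) (a δ : ℝ) : nearLevels n a δ ⊆ Finset.range (n + 1) :=
  Finset.filter_subset _ _

lemma farSum_anti {n : ℕ} {δ δ' : ℝ} (h : δ ≤ δ') : farSum n δ' ≤ farSum n δ := by
  refine Finset.sum_le_sum_of_subset_of_nonneg (Finset.sdiff_subset_sdiff le_rfl fun k hk => ?_)
    fun _ _ _ => levelWeight_nonneg _ _ _
  rw [mem_nearLevels] at hk ⊢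
  exact ⟨hk.1, hk.2.trans_le h⟩

/-- At equal height `E = 2^n` the flatter maximum has more mass: `√n/N` is `n^(1/4)` at `1/2` and
`1` at `19/20`. The remaining levels contribute at most `(n + 1) e^(-nκ) E`. -/
lemma exists_farSum_div_le : ∃ δ₀ : ℝ, 0 < δ₀ ∧ ∀ δ, 0 < δ → δ < δ₀ → ∃ C : ℝ,
    ∀ᶠ n : ℕ in atTop, farSum n δ / partitionSum energy n ≤ C * (1 / fluctScale 2 n) := by
  have R₁ := isRegularMaximizer_half
  have R₂ := isRegularMaximizer_nineteen_div_twenty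
  obtain ⟨δ₁, c₁, _, hδ₁, hc₁, _, h₁⟩ := exists_nearLevels_mass (f := energy) R₁.1 R₁.2.1.1
    R₁.2.1.2 (analyticAt_freeEnergy R₁.2.1) R₁.2.2.2.2.1 (decayRate_pos_of_isRegularMaximizer R₁)
  obtain ⟨δ₂, _, c₂, hδ₂, _, hc₂, h₂⟩ := exists_nearLevels_mass (f := energy) R₂.1 R₂.2.1.1
    R₂.2.1.2 (analyticAt_freeEnergy R₂.2.1) R₂.2.2.2.2.1 (decayRate_pos_of_isRegularMaximizer R₂)
  refine ⟨min δ₁ δ₂, lt_min hδ₁ hδ₂, fun δ hδ hδ' => ?_⟩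
  obtain ⟨hd₁, hd₂⟩ := lt_min_iff.1 hδ'
  obtain ⟨κ, hκ, hgap⟩ := exists_freeEnergy_gap hδ
  refine ⟨(c₂ + (1 / κ + 1)) / c₁, ?_⟩
  filter_upwards [h₁ δ hδ hd₁, h₂ δ hδ hd₂, eventually_gt_atTop 0] with n hn₁ hn₂ hn
  replace hn₁ := hn₁.1
  replace hn₂ := hn₂.2
  have hn' : (0 : ℝ) < n := by positivity
  have e₁ : energy (1 / 2) + Real.binEntropy (1 / 2) = Real.log 2 := freeEnergy_half
  have e₂ : energy (19 / 20) + Real.binEntropy (19 / 20) = Real.log 2 :=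
    freeEnergy_nineteen_div_twenty
  rw [e₁] at hn₁
  rw [e₂] at hn₂
  set E := Real.exp (n * Real.log 2) with hE
  have hE0 : 0 < E := Real.exp_pos _
  have hN1 := fluctScale_pos (m := 1) hn
  have hN2 := fluctScale_pos (m := 2) hn
  have hs1 : √(n : ℝ) = fluctScale 1 n := by
    rw [← fluctScale_pow (m := 1) (n := n) le_rfl]
    exact Real.sqrt_sq hN1.le
  have hs2 : √(n : ℝ) = fluctScale 2 n ^ 2 := by
    rw [← fluctScale_pow (m := 2) (n := n) one_le_two, pow_mul]
    exact Real.sqrt_sq (by positivity)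
  rw [hs2, sq, mul_div_assoc, div_self hN2.ne', mul_one] at hn₁
  rw [hs1, div_self hN1.ne', one_mul] at hn₂
  have hZ : c₁ * (fluctScale 2 n * E) ≤ partitionSum energy n :=
    hn₁.trans (Finset.sum_le_sum_of_subset_of_nonneg (nearLevels_subset _ _ _)
      fun _ _ _ => levelWeight_nonneg _ _ _)
  have hfar : farSum n δ ≤ c₂ * E + (1 / κ + 1) * E := by
    have hsplit : farSum n δ ≤ ∑ k ∈ nearLevels n (19 / 20) δ, levelWeight energy n k
        + ∑ _k ∈ Finset.range (n + 1), Real.exp (-(n * κ)) * E := by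
      classical
      rw [farSum, ← Finset.sum_inter_add_sum_sdiff _ (nearLevels n (19 / 20) δ)]
      refine add_le_add (Finset.sum_le_sum_of_subset_of_nonneg Finset.inter_subset_right
        fun _ _ _ => levelWeight_nonneg _ _ _) ?_
      refine (Finset.sum_le_sum fun k hk => ?_).trans (Finset.sum_le_sum_of_subset_of_nonneg
        (Finset.sdiff_subset.trans Finset.sdiff_subset) fun _ _ _ => by positivity)
      simp only [Finset.mem_sdiff, Finset.mem_range, Nat.lt_succ_iff, mem_nearLevels, not_and,
        not_lt] at hk
      obtain ⟨⟨hk0, hk1⟩, hk2⟩ := hk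
      refine (levelWeight_le hn hk0).trans ?_
      rw [hE, ← Real.exp_add]
      have hmem : (k / n : ℝ) ∈ Icc (0 : ℝ) 1 :=
        ⟨by positivity, div_le_one_of_le₀ (by exact_mod_cast hk0) hn'.le⟩
      have hg : energy (k / n) + Real.binEntropy (k / n) ≤ Real.log 2 - κ :=
        hgap _ hmem (hk1 hk0) (hk2 hk0)
      gcongr
      nlinarith
    -- Boundedness is enough here, since the denominator already carries the factor `n^(1/4)`.
    have hexp : ((n : ℝ) + 1) * Real.exp (-(n * κ)) ≤ 1 / κ + 1 := by
      have h1 := Real.add_one_le_exp (n * κ)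
      have h2 : 0 ≤ n * κ := by positivity
      rw [Real.exp_neg, ← div_eq_mul_inv, div_le_iff₀ (Real.exp_pos _)]
      have h3 : (n : ℝ) = 1 / κ * (n * κ) := by field_simp
      have h4 : 1 / κ * (n * κ) ≤ 1 / κ * Real.exp (n * κ) := by gcongr; linarith
      nlinarith
    refine hsplit.trans ?_
    rw [Finset.sum_const, Finset.card_range, nsmul_eq_mul]
    push_cast
    nlinarith
  calc farSum n δ / partitionSum energy n
      ≤ (c₂ * E + (1 / κ + 1) * E) / (c₁ * (fluctScale 2 n * E)) := by
        have : 0 < c₁ * (fluctScale 2 n * E) := by positivity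
        gcongr
    _ = (c₂ + (1 / κ + 1)) / c₁ * (1 / fluctScale 2 n) := by field_simp

lemma tendsto_farSum_div {δ : ℝ} (hδ : 0 < δ) :
    Tendsto (fun n => farSum n δ / partitionSum energy n) atTop (𝓝 0) := by
  obtain ⟨δ₀, hδ₀, h⟩ := exists_farSum_div_le
  -- The far mass decreases in `δ`, so a bound at a smaller radius covers every `δ > 0`.
  obtain ⟨C, hC⟩ := h (min δ (δ₀ / 2)) (lt_min hδ (half_pos hδ₀))
    ((min_le_right _ _).trans_lt (half_lt_self hδ₀))
  have hlim : Tendsto (fun n => C * (1 / fluctScale 2 n)) atTop (𝓝 (C * 0)) :=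
    (tendsto_const_nhds.div_atTop (tendsto_fluctScale one_le_two)).const_mul C
  rw [mul_zero] at hlim
  refine squeeze_zero' (Eventually.of_forall fun n => div_nonneg (farSum_nonneg n δ)
    (partitionSum_pos _ _).le) ?_ hlim
  filter_upwards [hC] with n hn
  refine le_trans ?_ hn
  have := partitionSum_pos energy n
  gcongr
  exact farSum_anti (min_le_left _ _)

lemma abs_integral_gibbs_sub_le {n : ℕ} {δ e B : ℝ} {H : ℕ → ℝ} {h₀ : ℝ}
    (hB : ∀ k, |H k - h₀| ≤ B) (he : 0 ≤ e) (hnear : ∀ k ∈ nearLevels n (1 / 2) δ, |H k - h₀| ≤ e) :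
    |∫ ω, H (plusCount ω) ∂(gibbs energy n) - h₀| ≤ e + B * (farSum n δ / partitionSum energy n) := by
  have hZ := partitionSum_pos energy n
  have hB0 : 0 ≤ B := (abs_nonneg _).trans (hB 0)
  have e1 : (∑ k ∈ Finset.range (n + 1), H k * levelWeight energy n k) / partitionSum energy n - h₀
      = (∑ k ∈ Finset.range (n + 1), (H k - h₀) * levelWeight energy n k)
        / partitionSum energy n := by
    simp only [sub_mul, Finset.sum_sub_distrib, ← Finset.mul_sum]
    rw [← partitionSum]
    field_simp
  rw [integral_gibbs, e1, abs_div, abs_of_pos hZ, div_le_iff₀ hZ, add_mul, mul_assoc,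
    div_mul_cancel₀ _ hZ.ne']
  refine (Finset.abs_sum_le_sum_abs _ _).trans ?_
  rw [← Finset.sum_sdiff (nearLevels_subset n (1 / 2) δ), add_comm]
  refine add_le_add ?_ ?_
  · calc _ ≤ ∑ k ∈ nearLevels n (1 / 2) δ, e * levelWeight energy n k := by
          refine Finset.sum_le_sum fun k hk => ?_
          rw [abs_mul, abs_of_nonneg (levelWeight_nonneg _ _ _)]
          exact mul_le_mul_of_nonneg_right (hnear k hk) (levelWeight_nonneg _ _ _)
      _ ≤ ∑ k ∈ Finset.range (n + 1), e * levelWeight energy n k :=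
          Finset.sum_le_sum_of_subset_of_nonneg (nearLevels_subset _ _ _)
            fun _ _ _ => mul_nonneg he (levelWeight_nonneg _ _ _)
      _ = _ := by rw [← Finset.mul_sum, partitionSum]
  · rw [farSum, Finset.mul_sum]
    refine Finset.sum_le_sum fun k _ => ?_
    rw [abs_mul, abs_of_nonneg (levelWeight_nonneg _ _ _)]
    exact mul_le_mul_of_nonneg_right (hB k) (levelWeight_nonneg _ _ _)

lemma tendstoInDistribution_magnetization :
    TendstoInDistribution (fun (n : ℕ) (ω : Config n) => magnetization ω / (n : ℝ)) atTop
      (fun _ : Unit => (0 : ℝ)) (fun n : ℕ => gibbs energy n) (Measure.dirac ()) := by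
  refine ⟨fun n => Measurable.of_discrete.aemeasurable, aemeasurable_const, ?_⟩
  refine ProbabilityMeasure.tendsto_iff_forall_integral_tendsto.2 fun F => ?_
  change Tendsto (fun n : ℕ => ∫ x, F x ∂((gibbs energy n).map
    fun ω : Config n => magnetization ω / (n : ℝ))) atTop
    (𝓝 (∫ x, F x ∂((Measure.dirac ()).map fun _ : Unit => (0 : ℝ))))
  have hlim : ∫ x, F x ∂((Measure.dirac ()).map fun _ : Unit => (0 : ℝ)) = F 0 := by
    rw [integral_map aemeasurable_const F.continuous.aestronglyMeasurable, integral_dirac]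
  have hval : ∀ n : ℕ, ∫ x, F x ∂((gibbs energy n).map
      fun ω : Config n => magnetization ω / (n : ℝ))
      = ∫ ω, (fun k : ℕ => F ((2 * k - n) / n)) (plusCount ω) ∂(gibbs energy n) := fun n => by
    rw [integral_map Measurable.of_discrete.aemeasurable F.continuous.aestronglyMeasurable]
    simp only [magnetization_eq]
  simp only [hlim, hval]
  rw [Metric.tendsto_nhds]
  intro ε hε
  obtain ⟨r, hr, hF⟩ := Metric.continuous_iff.1 F.continuous 0 (ε / 2) (half_pos hε)
  have hB : ∀ x, |F x - F 0| ≤ 2 * ‖F‖ := fun x => by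
    simpa [Real.dist_eq] using F.dist_le_two_norm x 0
  -- Radius `r/2` for the fraction of plus spins is radius `r` for the mean spin, as `M_n/n = 2(k/n
  -- - 1/2)`.
  have hfar := (tendsto_farSum_div (half_pos hr)).const_mul (2 * ‖F‖)
  rw [mul_zero] at hfar
  filter_upwards [hfar.eventually (gt_mem_nhds (half_pos hε)), eventually_gt_atTop 0] with n hn hn0
  have hn' : (0 : ℝ) < n := by positivity
  rw [Real.dist_eq]
  refine (abs_integral_gibbs_sub_le (n := n) (δ := r / 2) (e := ε / 2) (B := 2 * ‖F‖)
    (H := fun k : ℕ => F ((2 * k - n) / n)) (fun k => hB _)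
    (half_pos hε).le fun k hk => ?_).trans_lt (by linarith)
  have hk' := (mem_nearLevels.1 hk).2
  have := hF ((2 * k - n) / n) ?_
  · rw [Real.dist_eq] at this
    exact this.le
  · have e : ((2 * k - n) / n : ℝ) = 2 * (k / n - 1 / 2) := by field_simp
    rw [Real.dist_eq, sub_zero, e, abs_mul, abs_two]
    linarith

/-! ### The limiting laws -/

lemma integral_quarticLaw (g : ℝ → ℝ) :
    ∫ x, g x ∂quarticLaw = (∫ x, g x * Real.exp (-decayRate energy 2 (1 / 2) * x ^ (2 * 2)))
      / ∫ x, Real.exp (-decayRate energy 2 (1 / 2) * x ^ (2 * 2)) := by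
  have e : ∀ x : ℝ, iteratedDeriv 4 freeEnergy (1 / 2) * x ^ 4 / (2 ^ 4 * (Nat.factorial 4 : ℝ))
      = -decayRate energy 2 (1 / 2) * x ^ (2 * 2) := fun x => by
    rw [decayRate_energy, neg_neg]
    ring
  rw [quarticLaw, integral_tilted]
  simp only [e, smul_eq_mul]
  rw [← integral_div]
  congr 1
  funext x
  ring

lemma integral_gaussianLaw (g : ℝ → ℝ) :
    ∫ x, g x ∂gaussianLaw = (∫ x, g x * Real.exp (-decayRate energy 1 (19 / 20) * x ^ (2 * 1)))
      / ∫ x, Real.exp (-decayRate energy 1 (19 / 20) * x ^ (2 * 1)) := by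
  have hD := iteratedDeriv_two_freeEnergy_nineteen_div_twenty
  have hc := decayRate_pos_of_isRegularMaximizer isRegularMaximizer_nineteen_div_twenty
  -- The 8 is `2² · 2!`. The density `exp (-c x²)` is Gaussian of variance `1/(2c)`, which is then
  -- `4/|A''|`.
  have hcD : decayRate energy 1 (19 / 20) = |iteratedDeriv 2 freeEnergy (19 / 20)| / 8 := by
    rw [decayRate_energy, abs_of_neg hD]
    norm_num
    ring
  set c := decayRate energy 1 (19 / 20)
  have hv : (Real.toNNReal (4 / |iteratedDeriv 2 freeEnergy (19 / 20)|) : ℝ) = 1 / (2 * c) := by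
    have h8 : |iteratedDeriv 2 freeEnergy (19 / 20)| = 8 * c := by rw [hcD]; ring
    rw [h8, Real.coe_toNNReal _ (by positivity)]
    field_simp
    norm_num
  have hv0 : Real.toNNReal (4 / |iteratedDeriv 2 freeEnergy (19 / 20)|) ≠ 0 := by
    intro h
    rw [h] at hv
    have : 0 < 1 / (2 * c) := by positivity
    rw [← hv] at this
    simp at this
  have hpdf : ∀ x, gaussianPDFReal 0 (Real.toNNReal (4 / |iteratedDeriv 2 freeEnergy (19 / 20)|)) x
      = Real.exp (-c * x ^ (2 * 1)) / √(Real.pi / c) := fun x => by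
    rw [gaussianPDFReal, hv, div_eq_inv_mul (Real.exp _)]
    congr 3
    · field_simp
    · field_simp
      ring
  rw [gaussianLaw, integral_gaussianReal_eq_integral_smul hv0]
  simp only [hpdf, smul_eq_mul, mul_one]
  rw [integral_gaussian, ← integral_div]
  congr 1
  funext x
  ring

lemma exists_wassersteinDist_quarticLaw_le : ∃ δ₀ : ℝ, 0 < δ₀ ∧ ∀ δ : ℝ, 0 < δ → δ < δ₀ →
    ∃ C : ℝ, ∀ᶠ n : ℕ in atTop,
      wassersteinDist (((gibbs energy n)[|nearEvent n (1 / 2) δ]).map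
        fun ω => (n : ℝ) ^ (-(3 / 4) : ℝ) * magnetization ω)
        quarticLaw ≤ ENNReal.ofReal (C * (n : ℝ) ^ (-(1 / 4) : ℝ)) := by
  have R := isRegularMaximizer_half
  obtain ⟨δ₀, hδ₀, h⟩ := exists_wassersteinDist_le (f := energy) R.1 R.2.1.1 R.2.1.2
    (analyticAt_freeEnergy R.2.1) R.2.2.2.2.1 (decayRate_pos_of_isRegularMaximizer R)
    (ν := quarticLaw) fun g _ => integral_quarticLaw g
  refine ⟨δ₀, hδ₀, fun δ hδ hδ' => ?_⟩
  obtain ⟨C, hC⟩ := h δ hδ hδ'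
  refine ⟨C, ?_⟩
  filter_upwards [hC, eventually_gt_atTop 0] with n hn hn0
  have hn' : (0 : ℝ) < n := by positivity
  have hN : fluctScale 2 n = (n : ℝ) ^ (1 / 4 : ℝ) := by
    rw [fluctScale]; norm_num
  have e1 : 1 / fluctScale 2 n = (n : ℝ) ^ (-(1 / 4) : ℝ) := by
    rw [hN, Real.rpow_neg hn'.le, one_div]
  -- Hence `n^(-3/4) M_n = (N/n)(2k - n) = 2N(k/n - 1/2)`, the variable of the general bound.
  have e2 : (n : ℝ) ^ (-(3 / 4) : ℝ) = fluctScale 2 n / n := by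
    rw [hN, show (-(3 / 4) : ℝ) = 1 / 4 - 1 by norm_num, Real.rpow_sub_one hn'.ne']
  rw [e1] at hn
  convert hn using 3
  funext ω
  rw [e2, magnetization_eq]
  field_simp

lemma exists_wassersteinDist_gaussianLaw_le : ∃ δ₀ : ℝ, 0 < δ₀ ∧ ∀ δ : ℝ, 0 < δ → δ < δ₀ →
    ∃ C : ℝ, ∀ᶠ n : ℕ in atTop,
      wassersteinDist (((gibbs energy n)[|nearEvent n (19 / 20) δ]).map
        fun ω => (magnetization ω - 0.9 * (n : ℝ)) / Real.sqrt (n : ℝ))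
        gaussianLaw ≤ ENNReal.ofReal (C * (n : ℝ) ^ (-(1 / 2) : ℝ)) := by
  have R := isRegularMaximizer_nineteen_div_twenty
  obtain ⟨δ₀, hδ₀, h⟩ := exists_wassersteinDist_le (f := energy) R.1 R.2.1.1 R.2.1.2
    (analyticAt_freeEnergy R.2.1) R.2.2.2.2.1 (decayRate_pos_of_isRegularMaximizer R)
    (ν := gaussianLaw) fun g _ => integral_gaussianLaw g
  refine ⟨δ₀, hδ₀, fun δ hδ hδ' => ?_⟩
  obtain ⟨C, hC⟩ := h δ hδ hδ'
  refine ⟨C, ?_⟩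
  filter_upwards [hC, eventually_gt_atTop 0] with n hn hn0
  have hn' : (0 : ℝ) < n := by positivity
  have hN : fluctScale 1 n = (n : ℝ) ^ (1 / 2 : ℝ) := by
    rw [fluctScale]; norm_num
  have e1 : 1 / fluctScale 1 n = (n : ℝ) ^ (-(1 / 2) : ℝ) := by
    rw [hN, Real.rpow_neg hn'.le, one_div]
  have hs : √(n : ℝ) * √n = n := Real.mul_self_sqrt hn'.le
  have hs0 : √(n : ℝ) ≠ 0 := by positivity
  rw [e1, hN, ← Real.sqrt_eq_rpow] at hn
  convert hn using 3
  funext ω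
  rw [magnetization_eq, div_eq_iff hs0]
  have : 2 * √(n : ℝ) * (plusCount ω / n - 19 / 20) * √n
      = 2 * (√(n : ℝ) * √n) * (plusCount ω / n - 19 / 20) := by ring
  rw [this, hs]
  field_simp
  ring

end SixSpin

theorem mainTheorem7 :
    -- numerical values of the two coefficients, to four decimals
    (|SixSpin.beta - 0.1258| < 0.00005 ∧ |SixSpin.field - 0.0386| < 0.00005) ∧
    -- the maximizers of `A` and their regularity
    {a : ℝ | a ∈ Icc (0 : ℝ) 1 ∧ IsMaxOn SixSpin.freeEnergy (Icc 0 1) a} = {1 / 2, 19 / 20} ∧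
    SixSpin.IsRegularMaximizer SixSpin.freeEnergy 2 (1 / 2) ∧
    SixSpin.IsRegularMaximizer SixSpin.freeEnergy 1 (19 / 20) ∧
    -- `M_n / n → 0` in law
    TendstoInDistribution
      (fun (n : ℕ) (ω : SixSpin.Config n) => SixSpin.magnetization ω / (n : ℝ)) atTop
      (fun _ : Unit => (0 : ℝ)) (fun n : ℕ => SixSpin.gibbs SixSpin.energy n)
      (Measure.dirac ()) ∧
    -- the conditional limit theorems, for every small `δ`
    ∃ δ₀ : ℝ, 0 < δ₀ ∧ ∀ δ : ℝ, 0 < δ → δ < δ₀ →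
      (∃ C : ℝ, ∀ᶠ n : ℕ in atTop,
        SixSpin.wassersteinDist
          (((SixSpin.gibbs SixSpin.energy n)[|SixSpin.nearEvent n (1 / 2) δ]).map
            fun ω => (n : ℝ) ^ (-(3 / 4) : ℝ) * SixSpin.magnetization ω)
          SixSpin.quarticLaw ≤ ENNReal.ofReal (C * (n : ℝ) ^ (-(1 / 4) : ℝ))) ∧
      (∃ C : ℝ, ∀ᶠ n : ℕ in atTop,
        SixSpin.wassersteinDist
          (((SixSpin.gibbs SixSpin.energy n)[|SixSpin.nearEvent n (19 / 20) δ]).map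
            fun ω => (SixSpin.magnetization ω - 0.9 * (n : ℝ)) / Real.sqrt (n : ℝ))
          SixSpin.gaussianLaw ≤ ENNReal.ofReal (C * (n : ℝ) ^ (-(1 / 2) : ℝ))) := by
  obtain ⟨δ₁, hδ₁, h₁⟩ := SixSpin.exists_wassersteinDist_quarticLaw_le
  obtain ⟨δ₂, hδ₂, h₂⟩ := SixSpin.exists_wassersteinDist_gaussianLaw_le
  exact ⟨⟨SixSpin.beta_near, SixSpin.field_near⟩, SixSpin.setOf_isMaxOn_freeEnergy,
    SixSpin.isRegularMaximizer_half, SixSpin.isRegularMaximizer_nineteen_div_twenty,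
    SixSpin.tendstoInDistribution_magnetization, min δ₁ δ₂, lt_min hδ₁ hδ₂, fun δ hδ hδ' =>
      ⟨h₁ δ hδ (hδ'.trans_le (min_le_left _ _)), h₂ δ hδ (hδ'.trans_le (min_le_right _ _))⟩⟩
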